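/- \textbf{Setting.} Let $R$ be an integral domain with field of fractions $\mathbb F$. A cellular algebra over $R$ is a unital $R$-algebra $A$ with an $R$-linear algebra involution $*$, a finite poset $(\widehat A,\unrhd)$, finite non-empty index sets $T(\lambda)$ $(\lambda\in\widehat A)$ and an $R$-basis $c^\lambda_{st}$ $(\lambda\in\widehat A,\ s,t\in T(\lambda))$ such that, with $A^{\rhd\lambda}$ the span of all $c^\mu_{st}$ with $\mu\rhd\lambda$, one has $(c^\lambda_{st})^*\equiv c^\lambda_{ts}$ and $c^\lambda_{st}a\equiv\sum_v r(a;t,v)\,c^\lambda_{sv}$ modulo $A^{\rhd\lambda}$, with $r(a;t,v)\in R$ independent of $s$. The cell module $\Delta(\lambda)$ is the right $A$-module with $R$-basis $c^\lambda_t$ $(t\in T(\lambda))$ and $c^\lambda_t a=\sum_v r(a;t,v)c^\lambda_v$; its bilinear form is given by $c^\lambda_{st}c^\lambda_{uv}\equiv\langle c^\lambda_t,c^\lambda_u\rangle c^\lambda_{sv}$ modulo $A^{\rhd\lambda}$. Put $A^{\mathbb F}=A\otimes_R\mathbb F$, a cellular algebra over $\mathbb F$ with cell modules $\Delta^{\mathbb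 F}(\lambda)=\Delta(\lambda)\otimes_R\mathbb F$. Let $A_0\subseteq A_1\subseteq A_2\subseteq\cdots$ be a sequence of cellular algebras over $R$, with unital inclusions and consistent involutions, with posets $\widehat A_r$ and cell modules $\Delta_r(\lambda)$, such that: (D1) $A_0=R$. (D2) Every $\Delta_r(\lambda)$ is a cyclic $A_r$-module; a generator $\delta_r(\lambda)=\sum_t g_tc^\lambda_t$ is fixed, together with $m_\lambda\in A_r$ such that $m_\lambda\equiv\sum_{s,t}g_sg_tc^\lambda_{st}$ modulo $A_r^{\rhd\lambda}$. (D3) $m_\lambda^*=m_\lambda$. (D4) $A_r^{\mathbb F}$ is split semisimple for all $r$. (D5) For $\mu\in\widehat A_{r+1}$ the restriction of $\Delta_{r+1}(\mu)$ to $A_r$ has a filtration $0=M_0\subseteq M_1\subseteq\cdots\subseteq M_n$, ending in $M_n=\Delta_{r+1}(\mu)$, by $A_r$-submodules, with isomorphisms $M_j/M_{j-1}\cong\Delta_r(\lambda^{(j)})$ and $\lambda^{(1)}\rhd\lambda^{(2)}\rhd\cdots\rhd\lambda^{(n)}$. Fix these; write $\lambda\to\mu$ if $\lambda$ is one of the $\lambda^{(j)}$,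 and fix $d_{\lambda^{(j)}\to\mu}\in A_{r+1}$ such that $\delta_{r+1}(\mu)d_{\lambda^{(j)}\to\mu}\in M_j$ and its class in $M_j/M_{j-1}$ corresponds to $\delta_r(\lambda^{(j)})$. (D6) For each edge $\lambda\to\mu$ with $\mu\in\widehat A_{r+1}$ there is $u\in A_{r+1}$ with $m_\mu d_{\lambda\to\mu}=u^*m_\lambda$. The branching diagram $\widehat A$ has vertex set $\widehat A_r$ at level $r$ and the edges above; $\widehat A_0$ is a singleton. Let ${\rm Std}_r(\nu)$ be the set of paths $\mathsf t=(\mathsf t(0)\to\cdots\to\mathsf t(r)=\nu)$ from level $0$ to $\nu\in\widehat A_r$, and ${\rm Std}_{s,r}(\nu\setminus\lambda)$ the set of paths from $\lambda\in\widehat A_s$ to $\nu$. Write $\mathsf t_{[p,q]}$ for truncation and $\circ$ for concatenation of paths. For $\mathsf s,\mathsf t\in{\rm Std}_r(\nu)$ put $d_{\mathsf t}=d_{\mathsf t(r-1)\to\mathsf t(r)}\cdots d_{\mathsf t(0)\to\mathsf t(1)}$, $m^\nu_{\mathsf t}=\delta_r(\nu)d_{\mathsf t}\in\Delta_r(\nu)$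 and $m^\nu_{\mathsf s\mathsf t}=d_{\mathsf s}^*m_\nu d_{\mathsf t}\in A_r$. Let $z_r^\lambda$ be the minimal central idempotent of $A_r^{\mathbb F}$ acting as the identity on $\Delta_r^{\mathbb F}(\lambda)$, and $F_{\mathsf t}=\prod_{i=1}^r z_i^{\mathsf t(i)}\in A_r^{\mathbb F}$. Put $$f^\nu_{\mathsf t}=m^\nu_{\mathsf t}F_{\mathsf t}\in\Delta_r^{\mathbb F}(\nu),\qquad F^\nu_{\mathsf s\mathsf t}=F_{\mathsf s}m^\nu_{\mathsf s\mathsf t}F_{\mathsf t}\in A_r^{\mathbb F}.$$ \textbf{Proposition.} Let $1\le s<r$, $\nu\in\widehat A_r$ and $\mathsf t\in{\rm Std}_r(\nu)$. Write $\lambda=\mathsf t(s)$, $\mathsf t_1=\mathsf t_{[0,s]}\in{\rm Std}_s(\lambda)$ and $\mathsf t_2=\mathsf t_{[s,r]}\in{\rm Std}_{s,r}(\nu\setminus\lambda)$. (1) If $x\in A_s^{\mathbb F}$ and $f^\lambda_{\mathsf t_1}x=\sum_{\mathsf s\in{\rm Std}_s(\lambda)}\alpha_{\mathsf s}f^\lambda_{\mathsf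 s}$ with $\alpha_{\mathsf s}\in\mathbb F$, then $f^\nu_{\mathsf t}x=\sum_{\mathsf s\in{\rm Std}_s(\lambda)}\alpha_{\mathsf s}f^\nu_{\mathsf s\circ\mathsf t_2}$. (2) For $\mu\in\widehat A_s$ and $\mathsf u,\mathsf v\in{\rm Std}_s(\mu)$: $f^\nu_{\mathsf t}F^\mu_{\mathsf u\mathsf v}=\langle f^\lambda_{\mathsf t_1},f^\lambda_{\mathsf t_1}\rangle f^\nu_{\mathsf v\circ\mathsf t_2}$ if $\mu=\lambda$ and $\mathsf u=\mathsf t_1$, and $f^\nu_{\mathsf t}F^\mu_{\mathsf u\mathsf v}=0$ otherwise. (3) If $x\in A_r^{\mathbb F}$ commutes with every element of $A_s^{\mathbb F}$, then there are coefficients $r_{\mathsf s}\in\mathbb F$ $(\mathsf s\in{\rm Std}_{s,r}(\nu\setminus\lambda))$ with $f^\nu_{\mathsf t}x=\sum_{\mathsf s}r_{\mathsf s}f^\nu_{\mathsf t_1\circ\mathsf s}$, and they depend only on $x$ and $\mathsf t_2$, not on $\mathsf t_1$: with the same coefficients, $f^\nu_{\mathsf v\circ\mathsf t_2}x=\sum_{\mathsf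 s}r_{\mathsf s}f^\nu_{\mathsf v\circ\mathsf s}$ for every $\mathsf v\in{\rm Std}_s(\lambda)$. -/

import Mathlib

open scoped TensorProduct Matrix

noncomputable section

namespace DiagramAlg


/-! ### Cellular algebras

The order relation `μ ⊵ lam` of the literature is written `lam ≤ μ`, and `μ ▷ lam` is `lam < μ`. -/

section Cellular

variable {R : Type*} [CommRing R] {A : Type*} [Ring A] [Algebra R A]

/-- The span of the basis elements `c^μ_{st}` with `μ ▷ lam`. -/
def gtSpan {Λ : Type*} [PartialOrder Λ] {T : Λ → Type*}
    (c : (Σ l : Λ, T l × T l) → A) (lam : Λ) : Submodule R A :=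
  Submodule.span R {x | ∃ (μ : Λ) (s t : T μ), lam < μ ∧ x = c ⟨μ, s, t⟩}

end Cellular

/-- A cell datum for the `R`-algebra `A`, with poset `Λ` and index sets `T lam`. -/
structure CellDatum (R : Type*) [CommRing R] (A : Type*) [Ring A] [Algebra R A]
    (Λ : Type*) [PartialOrder Λ] (T : Λ → Type*) [∀ l, Fintype (T l)] where
  /-- the algebra involution `*` -/
  inv : A →ₗ[R] A
  inv_mul : ∀ a b, inv (a * b) = inv b * inv a
  inv_inv : ∀ a, inv (inv a) = a
  /-- the cellular basis `c^lam_{st}` -/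
  basis : Module.Basis (Σ l : Λ, T l × T l) R A
  mul_cell : ∀ (lam : Λ) (t : T lam) (a : A), ∃ ρ : T lam → R, ∀ s : T lam,
    basis ⟨lam, s, t⟩ * a - ∑ v, ρ v • basis ⟨lam, s, v⟩ ∈ gtSpan (R := R) basis lam
  inv_cell : ∀ (lam : Λ) (s t : T lam),
    inv (basis ⟨lam, s, t⟩) - basis ⟨lam, t, s⟩ ∈ gtSpan (R := R) basis lam

namespace CellDatum

variable {R : Type*} [CommRing R] {A : Type*} [Ring A] [Algebra R A]
  {Λ : Type*} [PartialOrder Λ] {T : Λ → Type*} [∀ l, Fintype (T l)]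

/-- The matrix `(r(a; t, v))_{t,v}` of coefficients in
`c_{st} a ≡ ∑ v, r(a; t, v) c_{sv}` modulo `A^{▷ lam}` (see `coef_spec`), read off at `s = t`. -/
def coef (D : CellDatum R A Λ T) (lam : Λ) : A →ₗ[R] Matrix (T lam) (T lam) R where
  toFun a := Matrix.of fun t v => D.basis.repr (D.basis ⟨lam, t, t⟩ * a) ⟨lam, t, v⟩
  map_add' a b := by ext t v; simp [mul_add]
  map_smul' r a := by ext t v; simp

theorem repr_gtSpan (D : CellDatum R A Λ T) (lam : Λ) {x : A}
    (hx : x ∈ gtSpan (R := R) D.basis lam) (s t : T lam) :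
    D.basis.repr x ⟨lam, s, t⟩ = 0 := by
  classical
  unfold gtSpan at hx
  induction hx using Submodule.span_induction with
  | mem x h =>
    obtain ⟨μ, s', t', hμ, rfl⟩ := h
    rw [Module.Basis.repr_self, Finsupp.single_apply, if_neg]
    intro h
    exact hμ.ne' (congrArg Sigma.fst h)
  | zero => simp
  | add x y _ _ hx hy => simp [hx, hy]
  | smul r x _ hx => simp [hx]

theorem coef_eq (D : CellDatum R A Λ T) (lam : Λ) (t : T lam) (a : A) (ρ : T lam → R)
    (h : ∀ s : T lam, D.basis ⟨lam, s, t⟩ * a - ∑ v, ρ v • D.basis ⟨lam, s, v⟩ ∈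
      gtSpan (R := R) D.basis lam) (v : T lam) : D.coef lam a t v = ρ v := by
  classical
  have h1 := D.repr_gtSpan lam (h t) t v
  rw [map_sub, Finsupp.sub_apply, sub_eq_zero] at h1
  change D.basis.repr (D.basis ⟨lam, t, t⟩ * a) ⟨lam, t, v⟩ = _
  rw [h1, map_sum, Finsupp.finsetSum_apply, Finset.sum_eq_single v]
  · simp
  · intro b _ hb
    rw [map_smul, Module.Basis.repr_self, Finsupp.smul_apply, Finsupp.single_apply, if_neg]
    · simp
    · intro h
      simp only [Sigma.mk.injEq, heq_eq_eq, Prod.mk.injEq, true_and] at h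
      exact hb h
  · simp

theorem coef_spec (D : CellDatum R A Λ T) (lam : Λ) (a : A) (s t : T lam) :
    D.basis ⟨lam, s, t⟩ * a - ∑ v, D.coef lam a t v • D.basis ⟨lam, s, v⟩ ∈
      gtSpan (R := R) D.basis lam := by
  obtain ⟨ρ, hρ⟩ := D.mul_cell lam t a
  simp only [D.coef_eq lam t a ρ hρ]
  exact hρ s

/-- The right action of `A` on the cell module `Δ(lam)`. The module is `T lam → R`, with basis
`c_t = Pi.single t 1`, and `c_t · a = ∑ v, r(a; t, v) c_v`. -/
def act (D : CellDatum R A Λ T) {lam : Λ} (x : T lam → R) (a : A) : T lam → R :=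
  x ᵥ* D.coef lam a

/-- The canonical bilinear form on the cell module, determined by
`c_{st} c_{uv} ≡ ⟨c_t, c_u⟩ c_{sv}` modulo `A^{▷ lam}`, that is by `c_t · c_{uv} = ⟨c_t, c_u⟩ c_v`. -/
def form (D : CellDatum R A Λ T) {lam : Λ} (x y : T lam → R) : R :=
  ∑ t, ∑ u, x t * y u * D.coef lam (D.basis ⟨lam, u, u⟩) t u

theorem gtSpan_baseChange (S : Type*) [CommRing S] [Algebra R S] (D : CellDatum R A Λ T)
    (lam : Λ) {x : A} (hx : x ∈ gtSpan (R := R) D.basis lam) (c : S) :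
    c ⊗ₜ[R] x ∈ gtSpan (R := S) (A := S ⊗[R] A) (D.basis.baseChange S) lam := by
  unfold gtSpan at hx
  induction hx using Submodule.span_induction with
  | mem x h =>
    obtain ⟨μ, s', t', hμ, rfl⟩ := h
    have : c ⊗ₜ[R] D.basis ⟨μ, s', t'⟩ = c • (D.basis.baseChange S) ⟨μ, s', t'⟩ := by
      rw [Module.Basis.baseChange_apply, TensorProduct.smul_tmul', smul_eq_mul, mul_one]
    rw [this]
    exact Submodule.smul_mem _ _ (Submodule.subset_span ⟨μ, s', t', hμ, rfl⟩)
  | zero => simp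
  | add x y _ _ hx hy => rw [TensorProduct.tmul_add]; exact add_mem hx hy
  | smul r x _ hx =>
    rw [TensorProduct.tmul_smul, ← algebraMap_smul S r]
    exact Submodule.smul_mem _ _ hx

/-- The specialization of a cell datum: `S ⊗ A` is cellular with basis `1 ⊗ c^lam_{st}`. -/
def baseChange (S : Type*) [CommRing S] [Algebra R S] (D : CellDatum R A Λ T) :
    CellDatum S (S ⊗[R] A) Λ T where
  inv := D.inv.baseChange S
  inv_mul a b := by
    induction a using TensorProduct.induction_on with
    | zero => simp
    | add x y hx hy => rw [add_mul, map_add, hx, hy, map_add, mul_add]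
    | tmul f a =>
      induction b using TensorProduct.induction_on with
      | zero => simp
      | add x y hx hy => rw [mul_add, map_add, hx, hy, map_add, add_mul]
      | tmul g b =>
        simp only [Algebra.TensorProduct.tmul_mul_tmul, LinearMap.baseChange_tmul, D.inv_mul,
          mul_comm f g]
  inv_inv a := by
    induction a using TensorProduct.induction_on with
    | zero => simp
    | add x y hx hy => rw [map_add, map_add, hx, hy]
    | tmul f a => simp [D.inv_inv]
  basis := D.basis.baseChange S
  mul_cell lam t a := by
    induction a using TensorProduct.induction_on with
    | zero => exact ⟨0, fun s => by simp⟩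
    | add x y hx hy =>
      obtain ⟨ρ, hρ⟩ := hx
      obtain ⟨σ, hσ⟩ := hy
      refine ⟨ρ + σ, fun s => ?_⟩
      convert add_mem (hρ s) (hσ s) using 1
      simp only [mul_add, Pi.add_apply, add_smul, Finset.sum_add_distrib]
      abel
    | tmul f a =>
      refine ⟨fun v => f * algebraMap R S (D.coef lam a t v), fun s => ?_⟩
      convert D.gtSpan_baseChange S lam (D.coef_spec lam a s t) f using 1
      rw [TensorProduct.tmul_sub, TensorProduct.tmul_sum]
      simp only [Module.Basis.baseChange_apply, Algebra.TensorProduct.tmul_mul_tmul, one_mul,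
        TensorProduct.smul_tmul', smul_eq_mul, mul_one, TensorProduct.tmul_smul]
      congr 1
      refine Finset.sum_congr rfl fun v _ => ?_
      rw [Algebra.smul_def, mul_comm]
  inv_cell lam s t := by
    convert D.gtSpan_baseChange S lam (D.inv_cell lam s t) 1 using 1
    rw [TensorProduct.tmul_sub]
    simp

end CellDatum

/-- Split semisimple: a finite product of matrix algebras over the ground field. -/
def SplitSemisimple (K : Type*) [Field K] (E : Type*) [Ring E] [Algebra K E] : Prop :=
  ∃ (n : ℕ) (k : Fin n → ℕ),
    Nonempty (E ≃ₐ[K] ∀ i : Fin n, Matrix (Fin (k i)) (Fin (k i)) K)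

/-- Minimal central idempotents of a ring. -/
def IsMinCentralIdem {E : Type*} [Ring E] (e : E) : Prop :=
  e ≠ 0 ∧ IsIdempotentElem e ∧ e ∈ Set.center E ∧
    ∀ f : E, IsIdempotentElem f → f ∈ Set.center E → f * e = f → f = 0 ∨ f = e

/-- Given `ι : A → A'` and cell data on both algebras, an order preserving cell filtration
`0 = M 0 ⊆ M 1 ⊆ ⋯ ⊆ M len` of the restriction to `A` of the cell module of `A'` labelled by `μ`.
The isomorphism `M (j+1) / M j ≅ Δ(label j)` of right `A`-modules is recorded as a surjective
`A`-linear map `quot j` from `M (j+1)` with kernel `M j`. -/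
structure CellFiltration {R : Type*} [CommRing R]
    {A : Type*} [Ring A] [Algebra R A] {A' : Type*} [Ring A'] [Algebra R A']
    {Λ : Type*} [PartialOrder Λ] {T : Λ → Type*} [∀ l, Fintype (T l)]
    {Λ' : Type*} [PartialOrder Λ'] {T' : Λ' → Type*} [∀ l, Fintype (T' l)]
    (ι : A →ₐ[R] A') (D : CellDatum R A Λ T) (D' : CellDatum R A' Λ' T') (μ : Λ') where
  len : ℕ
  M : Fin (len + 1) → Submodule R (T' μ → R)
  label : Fin len → Λ
  bot : M 0 = ⊥
  top : M (Fin.last len) = ⊤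
  mono : Monotone M
  stable : ∀ j, ∀ x ∈ M j, ∀ a : A, D'.act x (ι a) ∈ M j
  quot : ∀ j : Fin len, M j.succ →ₗ[R] (T (label j) → R)
  quot_surjective : ∀ j, Function.Surjective (quot j)
  quot_ker : ∀ j (x : M j.succ), quot j x = 0 ↔ (x : T' μ → R) ∈ M j.castSucc
  quot_act : ∀ j (x : M j.succ) (a : A),
    quot j ⟨D'.act x (ι a), stable _ _ x.2 a⟩ = D.act (quot j x) a
  /-- order preserving: `label 0 ▷ label 1 ▷ ⋯` -/
  order : ∀ i j : Fin len, i < j → label j < label i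

/-- A sequence of diagram algebras `A 0 ⊆ A 1 ⊆ ⋯` over `R` (inside some algebra `B`, for instance
their union), together with the choices of generators of cell modules, of the elements `m`, of
the order preserving cell filtrations and of the branching factors. `F` is the fraction field. -/
structure DiagramTower (R : Type*) [CommRing R] (F : Type*) [Field F] [Algebra R F]
    {B : Type*} [Ring B] [Algebra R B] (A : ℕ → Subalgebra R B)
    (Λ : ℕ → Type*) [∀ r, PartialOrder (Λ r)]
    (T : ∀ r, Λ r → Type*) [∀ r l, Fintype (T r l)] where
  mono : Monotone A
  cell : ∀ r, CellDatum R (A r) (Λ r) (T r)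
  /-- the involutions are consistent -/
  inv_compat : ∀ r (a : A r),
    (cell (r + 1)).inv (Subalgebra.inclusion (mono r.le_succ) a) =
      Subalgebra.inclusion (mono r.le_succ) ((cell r).inv a)
  /-- `A 0 = R` -/
  zero : Function.Bijective (algebraMap R (A 0))
  /-- the generator of the cyclic cell module -/
  gen : ∀ r (l : Λ r), T r l → R
  gen_cyclic : ∀ r (l : Λ r) (x : T r l → R), ∃ a : A r, (cell r).act (gen r l) a = x
  /-- the lift `m` of `gen^* ⊗ gen`, where `c_s^* ⊗ c_t` corresponds to `c_{st} + A^{▷ l}` -/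
  m : ∀ r, Λ r → A r
  m_lift : ∀ r (l : Λ r),
    m r l - ∑ s, ∑ t, (gen r l s * gen r l t) • (cell r).basis ⟨l, s, t⟩ ∈
      gtSpan (R := R) (cell r).basis l
  m_symm : ∀ r (l : Λ r), (cell r).inv (m r l) = m r l
  split : ∀ r, SplitSemisimple F (F ⊗[R] A r)
  /-- restriction coherence -/
  fil : ∀ r (μ : Λ (r + 1)),
    CellFiltration (Subalgebra.inclusion (mono r.le_succ)) (cell r) (cell (r + 1)) μ
  /-- the branching factor of the edge `l → μ` (irrelevant if there is no such edge) -/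
  d : ∀ r, Λ r → Λ (r + 1) → A (r + 1)
  d_spec : ∀ r (μ : Λ (r + 1)) (j : Fin (fil r μ).len),
    ∃ h : (cell (r + 1)).act (gen (r + 1) μ) (d r ((fil r μ).label j) μ) ∈ (fil r μ).M j.succ,
      (fil r μ).quot j ⟨_, h⟩ = gen r ((fil r μ).label j)
  /-- compatibility: existence of the `u`-branching factors -/
  u_exists : ∀ r (μ : Λ (r + 1)) (j : Fin (fil r μ).len), ∃ u : A (r + 1),
    m (r + 1) μ * d r ((fil r μ).label j) μ =
      (cell (r + 1)).inv u * Subalgebra.inclusion (mono r.le_succ) (m r ((fil r μ).label j))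

namespace DiagramTower

variable {R : Type*} [CommRing R] {F : Type*} [Field F] [Algebra R F]
  {B : Type*} [Ring B] [Algebra R B] {A : ℕ → Subalgebra R B}
  {Λ : ℕ → Type*} [∀ r, PartialOrder (Λ r)]
  {T : ∀ r, Λ r → Type*} [∀ r l, Fintype (T r l)]

/-! ### The branching diagram and its paths -/

/-- The edge `l → μ` of the branching diagram: `Δ(l)` is a subquotient of the cell filtration of
the restriction of `Δ(μ)`. -/
def Edge (𝒟 : DiagramTower R F A Λ T) {r : ℕ} (l : Λ r) (μ : Λ (r + 1)) : Prop :=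
  ∃ j, (𝒟.fil r μ).label j = l

/-- Paths `t(s) → t(s+1) → ⋯ → t(r)` on the branching diagram. -/
def Path (𝒟 : DiagramTower R F A Λ T) (s r : ℕ) : Type _ :=
  {t : ∀ i : Set.Icc s r, Λ i // ∀ (i : ℕ) (h₁ : s ≤ i) (h₂ : i + 1 ≤ r),
    𝒟.Edge (t ⟨i, h₁, (Nat.le_succ i).trans h₂⟩) (t ⟨i + 1, h₁.trans (Nat.le_succ i), h₂⟩)}

/-- The vertex `t(i)`. -/
def Path.at {𝒟 : DiagramTower R F A Λ T} {s r : ℕ} (t : 𝒟.Path s r) (i : ℕ)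
    (h₁ : s ≤ i) (h₂ : i ≤ r) : Λ i := t.1 ⟨i, h₁, h₂⟩

/-- The truncation `t_{[p, q]}`. -/
def Path.trunc {𝒟 : DiagramTower R F A Λ T} {s r : ℕ} (t : 𝒟.Path s r) (p q : ℕ)
    (hp : s ≤ p) (hq : q ≤ r) : 𝒟.Path p q :=
  ⟨fun i => t.at i (hp.trans i.2.1) (i.2.2.trans hq),
   fun i h₁ h₂ => t.2 i (hp.trans h₁) (h₂.trans hq)⟩

/-- The concatenation `p ∘ q`. -/
def Path.concat {𝒟 : DiagramTower R F A Λ T} {q s r : ℕ} (a : 𝒟.Path q s) (b : 𝒟.Path s r)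
    (hqs : q ≤ s) (hsr : s ≤ r) (h : a.at s hqs le_rfl = b.at s le_rfl hsr) : 𝒟.Path q r :=
  ⟨fun i => if hi : i.1 ≤ s then a.at i i.2.1 hi else b.at i (le_of_not_ge hi) i.2.2, by
    intro i h₁ h₂
    rcases lt_trichotomy i s with hi | rfl | hi
    · have h3 : i ≤ s := hi.le
      have h4 : i + 1 ≤ s := hi
      simp only [h3, h4, dite_true]
      exact a.2 i h₁ h4
    · have h4 : ¬ i + 1 ≤ i := by omega
      simp only [le_refl, h4, dite_true, dite_false, h]
      exact b.2 i le_rfl h₂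
    · have h3 : ¬ i ≤ s := by omega
      have h4 : ¬ i + 1 ≤ s := by omega
      simp only [h3, h4, dite_false]
      exact b.2 i hi.le h₂⟩

/-- Standard tableaux of shape `ν`: paths from level `0` (which has a single vertex) to `ν`. -/
def Std (𝒟 : DiagramTower R F A Λ T) {r : ℕ} (ν : Λ r) : Type _ :=
  {t : 𝒟.Path 0 r // t.at r (Nat.zero_le r) le_rfl = ν}

/-- Skew standard tableaux of shape `ν ∖ l`: paths from `l` to `ν`. -/
def SkewStd (𝒟 : DiagramTower R F A Λ T) {s r : ℕ} (hsr : s ≤ r) (l : Λ s) (ν : Λ r) : Type _ :=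
  {t : 𝒟.Path s r // t.at s le_rfl hsr = l ∧ t.at r hsr le_rfl = ν}

instance (𝒟 : DiagramTower R F A Λ T) [∀ r, Finite (Λ r)] (s r : ℕ) : Finite (𝒟.Path s r) := by
  unfold Path; infer_instance

instance (𝒟 : DiagramTower R F A Λ T) [∀ r, Finite (Λ r)] {r : ℕ} (ν : Λ r) :
    Fintype (𝒟.Std ν) := by
  haveI : Finite (𝒟.Std ν) := by unfold Std; infer_instance
  exact Fintype.ofFinite _

instance (𝒟 : DiagramTower R F A Λ T) [∀ r, Finite (Λ r)] {s r : ℕ} (hsr : s ≤ r)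
    (l : Λ s) (ν : Λ r) : Fintype (𝒟.SkewStd hsr l ν) := by
  haveI : Finite (𝒟.SkewStd hsr l ν) := by unfold SkewStd; infer_instance
  exact Fintype.ofFinite _

/-- The truncation `t_{[0, s]}` of `t ∈ Std_r(ν)`, of shape `t(s)`. -/
def Std.head {𝒟 : DiagramTower R F A Λ T} {r : ℕ} {ν : Λ r} (t : 𝒟.Std ν) (s : ℕ) (hsr : s ≤ r) :
    𝒟.Std (t.1.at s (Nat.zero_le s) hsr) :=
  ⟨t.1.trunc 0 s le_rfl hsr, rfl⟩

/-- The truncation `t_{[s, r]}` of `t ∈ Std_r(ν)`, of shape `ν ∖ t(s)`. -/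
def Std.tail {𝒟 : DiagramTower R F A Λ T} {r : ℕ} {ν : Λ r} (t : 𝒟.Std ν) (s : ℕ) (hsr : s ≤ r) :
    𝒟.SkewStd hsr (t.1.at s (Nat.zero_le s) hsr) ν :=
  ⟨t.1.trunc s r (Nat.zero_le s) le_rfl, rfl, t.2⟩

/-- The concatenation `p ∘ q ∈ Std_r(ν)` of `p ∈ Std_s(l)` and `q ∈ Std_{s,r}(ν ∖ l)`. -/
def Std.comp {𝒟 : DiagramTower R F A Λ T} {s r : ℕ} {hsr : s ≤ r} {l : Λ s} {ν : Λ r}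
    (p : 𝒟.Std l) (q : 𝒟.SkewStd hsr l ν) : 𝒟.Std ν :=
  ⟨p.1.concat q.1 (Nat.zero_le s) hsr (p.2.trans q.2.1.symm), by
    by_cases h : r ≤ s
    · obtain rfl : r = s := le_antisymm h hsr
      have h1 := p.2
      have h2 := q.2.1
      have h3 := q.2.2
      simp only [Path.at, Path.concat, le_refl, dite_true] at h1 h2 h3 ⊢
      rw [h1, ← h2, h3]
    · have h3 := q.2.2
      simp only [Path.at, Path.concat, h, dite_false] at h3 ⊢
      exact h3⟩

/-! ### The Murphy basis, Gelfand--Zeitlin idempotents and seminormal bases -/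

/-- The inclusion `A s → A r`. -/
def incl (𝒟 : DiagramTower R F A Λ T) {s r : ℕ} (h : s ≤ r) : A s →ₐ[R] A r :=
  Subalgebra.inclusion (𝒟.mono h)

/-- The inclusion `A_s^F → A_r^F`. -/
def inclF (𝒟 : DiagramTower R F A Λ T) {s r : ℕ} (h : s ≤ r) : F ⊗[R] A s →ₐ[F] F ⊗[R] A r :=
  Algebra.TensorProduct.map (AlgHom.id F F) (𝒟.incl h)

/-- The cell datum of `A_r^F`. -/
def cellF (𝒟 : DiagramTower R F A Λ T) (r : ℕ) : CellDatum F (F ⊗[R] A r) (Λ r) (T r) :=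
  (𝒟.cell r).baseChange F

/-- `d_{t(k-1) → t(k)} ⋯ d_{t(0) → t(1)}` -/
def dUpTo (𝒟 : DiagramTower R F A Λ T) {r : ℕ} (t : 𝒟.Path 0 r) : ∀ k : ℕ, k ≤ r → A k
  | 0, _ => 1
  | k + 1, h =>
    𝒟.d k (t.at k (Nat.zero_le k) ((Nat.le_succ k).trans h)) (t.at (k + 1) (Nat.zero_le _) h) *
      𝒟.incl k.le_succ (𝒟.dUpTo t k ((Nat.le_succ k).trans h))

/-- The product `d_t` of branching factors along `t`. -/
def dPath (𝒟 : DiagramTower R F A Λ T) {r : ℕ} (t : 𝒟.Path 0 r) : A r := 𝒟.dUpTo t r le_rfl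

/-- The Murphy basis `m_t` of the cell module `Δ_r(ν)`. Under the isomorphism of
`(m A + A^{▷ ν}) / A^{▷ ν}` with `Δ_r(ν)` which takes the class of `m` to the generator, this is the
class of `m d_t`. -/
def murphy (𝒟 : DiagramTower R F A Λ T) {r : ℕ} {ν : Λ r} (t : 𝒟.Std ν) : T r ν → R :=
  (𝒟.cell r).act (𝒟.gen r ν) (𝒟.dPath t.1)

/-- The Murphy cellular basis `m_{st} = d_s^* m d_t` of `A r`. -/
def murphyCell (𝒟 : DiagramTower R F A Λ T) {r : ℕ} {ν : Λ r} (s t : 𝒟.Std ν) : A r :=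
  (𝒟.cell r).inv (𝒟.dPath s.1) * 𝒟.m r ν * 𝒟.dPath t.1

/-- The minimal central idempotent of `A_r^F` labelled by `l`: the one that acts as the identity
on `Δ_r^F(l)`. -/
def centralIdem (𝒟 : DiagramTower R F A Λ T) {r : ℕ} (l : Λ r) : F ⊗[R] A r :=
  Classical.epsilon fun z =>
    IsMinCentralIdem z ∧ ∀ x : T r l → F, (𝒟.cellF r).act x z = x

/-- `∏_{1 ≤ i ≤ k} z_i^{t(i)}` (the factors commute) -/
def gzUpTo (𝒟 : DiagramTower R F A Λ T) {r : ℕ} (t : 𝒟.Path 0 r) : ∀ k : ℕ, k ≤ r → F ⊗[R] A k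
  | 0, _ => 1
  | k + 1, h =>
    𝒟.inclF k.le_succ (𝒟.gzUpTo t k ((Nat.le_succ k).trans h)) *
      𝒟.centralIdem (t.at (k + 1) (Nat.zero_le _) h)

/-- The Gelfand--Zeitlin idempotent `F_t`. -/
def gz (𝒟 : DiagramTower R F A Λ T) {r : ℕ} (t : 𝒟.Path 0 r) : F ⊗[R] A r := 𝒟.gzUpTo t r le_rfl

/-- The seminormal basis vector `f_t = m_t F_t` of `Δ_r^F(ν)`. -/
def seminormal (𝒟 : DiagramTower R F A Λ T) {r : ℕ} {ν : Λ r} (t : 𝒟.Std ν) : T r ν → F :=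
  (𝒟.cellF r).act (fun i => algebraMap R F (𝒟.murphy t i)) (𝒟.gz t.1)

/-- The seminormal element `F_{st} = F_s m_{st} F_t` of `A_r^F`. -/
def seminormalCell (𝒟 : DiagramTower R F A Λ T) {r : ℕ} {ν : Λ r} (s t : 𝒟.Std ν) :
    F ⊗[R] A r :=
  𝒟.gz s.1 * (1 ⊗ₜ[R] 𝒟.murphyCell s t) * 𝒟.gz t.1

end DiagramTower

end DiagramAlg

end

/-! Everything follows from one fact: over `F`, a path from `lam` to `ν` is an `A_s^F`-homomorphism
between cell modules, and these homomorphisms span all of them.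

A semisimple cellular algebra over a field is the product of the matrix algebras on its cell modules
(`eq_zero_of_coef_eq_zero`, `exists_coef_eq`). This gives the central idempotents z_l, their
invariance under the involution, and Schur's lemma for cell modules.

For an edge κ → μ, the assignment δ(κ)a ↦ δ(μ) d z_κ a is a well-defined embedding `branch` of
Δ^F(κ) into Δ^F(μ): by strictness of the order of the labels, z_κ kills the filtration layers below
the one labelled κ. Its image is the whole z_κ-component, and a non-edge has zero component. Since
d_t and F_t factor along the last edge, `branch` takes seminormal vectors to seminormal vectors
(`branch_seminormal`).

Composing along t₂ gives a homomorphism φ with φ(f_p) = f_{p∘t₂} (`exists_pathHom`). Parts (1) and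
(2) are therefore images under φ of identities at level s. For (3), if x commutes with A_s^F then y
↦ φ(y)x is again a homomorphism, hence a combination of path homomorphisms (`equivariant_mem_span`);
its coefficients are chosen before any tableau of shape `lam` is. -/

namespace DiagramAlg

/-! ### Cellular algebras: cell ideals, cell representations and the bilinear form -/

namespace CellDatum

section CommRing

variable {R : Type*} [CommRing R] {A : Type*} [Ring A] [Algebra R A]
  {Λ : Type*} [PartialOrder Λ] {T : Λ → Type*} [∀ l, Fintype (T l)]

theorem basis_mem_gtSpan (D : CellDatum R A Λ T) {lam μ : Λ} (h : lam < μ) (s t : T μ) :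
    D.basis ⟨μ, s, t⟩ ∈ gtSpan (R := R) D.basis lam :=
  Submodule.subset_span ⟨μ, s, t, h, rfl⟩

theorem gtSpan_anti (D : CellDatum R A Λ T) {lam μ : Λ} (h : lam ≤ μ) :
    gtSpan (R := R) D.basis μ ≤ gtSpan (R := R) D.basis lam := by
  refine Submodule.span_mono ?_
  rintro x ⟨κ, s, t, hκ, rfl⟩
  exact ⟨κ, s, t, h.trans_lt hκ, rfl⟩

theorem gtSpan_mul_mem (D : CellDatum R A Λ T) (lam : Λ) {x : A}
    (hx : x ∈ gtSpan (R := R) D.basis lam) (a : A) :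
    x * a ∈ gtSpan (R := R) D.basis lam := by
  have h : gtSpan (R := R) D.basis lam ≤
      (gtSpan (R := R) D.basis lam).comap (LinearMap.mulRight R a) := by
    conv_lhs => unfold gtSpan
    rw [Submodule.span_le]
    rintro x ⟨μ, s, t, hμ, rfl⟩
    have h1 := D.gtSpan_anti hμ.le (D.coef_spec μ a s t)
    have h2 : ∑ v, D.coef μ a t v • D.basis ⟨μ, s, v⟩ ∈ gtSpan (R := R) D.basis lam :=
      Submodule.sum_mem _ fun v _ => Submodule.smul_mem _ _ (D.basis_mem_gtSpan hμ s v)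
    simpa using add_mem h1 h2
  exact h hx

theorem inv_mem_gtSpan (D : CellDatum R A Λ T) (lam : Λ) {x : A}
    (hx : x ∈ gtSpan (R := R) D.basis lam) :
    D.inv x ∈ gtSpan (R := R) D.basis lam := by
  have h : gtSpan (R := R) D.basis lam ≤ (gtSpan (R := R) D.basis lam).comap D.inv := by
    conv_lhs => unfold gtSpan
    rw [Submodule.span_le]
    rintro x ⟨μ, s, t, hμ, rfl⟩
    simpa using add_mem (D.gtSpan_anti hμ.le (D.inv_cell μ s t)) (D.basis_mem_gtSpan hμ t s)
  exact h hx

theorem mul_gtSpan_mem (D : CellDatum R A Λ T) (lam : Λ) {x : A}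
    (hx : x ∈ gtSpan (R := R) D.basis lam) (a : A) :
    a * x ∈ gtSpan (R := R) D.basis lam := by
  have h := D.inv_mem_gtSpan lam (D.gtSpan_mul_mem lam (D.inv_mem_gtSpan lam hx) (D.inv a))
  rwa [D.inv_mul, D.inv_inv, D.inv_inv] at h

theorem coef_mul (D : CellDatum R A Λ T) (lam : Λ) (a b : A) :
    D.coef lam (a * b) = D.coef lam a * D.coef lam b := by
  ext t v
  refine D.coef_eq lam t (a * b) (fun v => (D.coef lam a * D.coef lam b) t v) (fun s => ?_) v
  have h1 := D.gtSpan_mul_mem lam (D.coef_spec lam a s t) b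
  have h2 : ∑ w, D.coef lam a t w • (D.basis ⟨lam, s, w⟩ * b -
      ∑ v, D.coef lam b w v • D.basis ⟨lam, s, v⟩) ∈ gtSpan (R := R) D.basis lam :=
    Submodule.sum_mem _ fun w _ => Submodule.smul_mem _ _ (D.coef_spec lam b s w)
  convert add_mem h1 h2 using 1
  simp only [smul_sub, Finset.sum_sub_distrib, sub_mul, Finset.sum_mul, smul_mul_assoc,
    Finset.smul_sum, Matrix.mul_apply, Finset.sum_smul, mul_assoc, smul_smul]
  rw [Finset.sum_comm]
  abel

theorem coef_one [∀ l, DecidableEq (T l)] (D : CellDatum R A Λ T) (lam : Λ) :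
    D.coef lam 1 = 1 := by
  ext t v
  refine D.coef_eq lam t 1 (fun v => (1 : Matrix (T lam) (T lam) R) t v) (fun s => ?_) v
  simp [Matrix.one_apply]

theorem inv_one (D : CellDatum R A Λ T) : D.inv 1 = 1 := by
  have h := D.inv_mul (D.inv 1) 1
  rw [mul_one, D.inv_inv, mul_one] at h
  exact h.symm

/-- The span is a two-sided ideal, so it contains every c_{st} x, and no basis element of `lam`
survives modulo it. -/
theorem coef_of_mem_gtSpan (D : CellDatum R A Λ T) (lam : Λ) {x : A}
    (hx : x ∈ gtSpan (R := R) D.basis lam) : D.coef lam x = 0 := by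
  ext t v
  refine D.coef_eq lam t x 0 (fun s => ?_) v
  simpa using D.mul_gtSpan_mem lam hx _

theorem act_mul (D : CellDatum R A Λ T) {lam : Λ} (x : T lam → R) (a b : A) :
    D.act x (a * b) = D.act (D.act x a) b := by
  simp [act, coef_mul]

theorem act_one (D : CellDatum R A Λ T) {lam : Λ} (x : T lam → R) : D.act x 1 = x := by
  classical
  simp [act, coef_one]

theorem zero_act (D : CellDatum R A Λ T) {lam : Λ} (a : A) : D.act (0 : T lam → R) a = 0 :=
  Matrix.zero_vecMul _

theorem smul_act (D : CellDatum R A Λ T) {lam : Λ} (c : R) (x : T lam → R) (a : A) :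
    D.act (c • x) a = c • D.act x a :=
  Matrix.smul_vecMul _ _ _

theorem act_smul (D : CellDatum R A Λ T) {lam : Λ} (c : R) (x : T lam → R) (a : A) :
    D.act x (c • a) = c • D.act x a := by
  simp [act, Matrix.vecMul_smul]

theorem add_act (D : CellDatum R A Λ T) {lam : Λ} (x y : T lam → R) (a : A) :
    D.act (x + y) a = D.act x a + D.act y a :=
  Matrix.add_vecMul _ _ _

theorem coef_eq_one [∀ l, DecidableEq (T l)] (D : CellDatum R A Λ T) {l : Λ} {z : A}
    (h : ∀ x : T l → R, D.act x z = x) : D.coef l z = 1 := by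
  ext i j
  have := congrFun (h (Pi.single i 1)) j
  simpa [act, Matrix.one_apply, Pi.single_apply, eq_comm] using this

/-- The action on a cell module as a bilinear map. -/
noncomputable def actₗ (D : CellDatum R A Λ T) (lam : Λ) :
    (T lam → R) →ₗ[R] A →ₗ[R] (T lam → R) :=
  LinearMap.mk₂ R D.act (fun x y a => Matrix.add_vecMul _ _ _)
    (fun c x a => Matrix.smul_vecMul _ _ _)
    (fun x a b => by simp [act, Matrix.vecMul_add])
    (fun c x a => by simp [act, Matrix.vecMul_smul])

@[simp]
theorem actₗ_apply (D : CellDatum R A Λ T) (lam : Λ) (x : T lam → R) (a : A) :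
    D.actₗ lam x a = D.act x a := rfl

/-- Left multiplication rule, obtained by applying the involution to the right one. -/
theorem mul_basis_sub_mem (D : CellDatum R A Λ T) (lam : Λ) (a : A) (u v : T lam) :
    a * D.basis ⟨lam, u, v⟩ - ∑ w, D.coef lam (D.inv a) u w • D.basis ⟨lam, w, v⟩ ∈
      gtSpan (R := R) D.basis lam := by
  have h1 := D.inv_mem_gtSpan lam (D.coef_spec lam (D.inv a) v u)
  have h2 := D.mul_gtSpan_mem lam (D.inv_cell lam v u) a
  have h3 : ∑ w, D.coef lam (D.inv a) u w • (D.inv (D.basis ⟨lam, v, w⟩) - D.basis ⟨lam, w, v⟩) ∈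
      gtSpan (R := R) D.basis lam :=
    Submodule.sum_mem _ fun w _ => Submodule.smul_mem _ _ (D.inv_cell lam v w)
  convert add_mem (sub_mem h1 h2) h3 using 1
  simp only [map_sub, D.inv_mul, D.inv_inv, map_sum, map_smul, smul_sub, Finset.sum_sub_distrib,
    mul_sub]
  abel

/-- The Gram matrix of the bilinear form on the cell module. -/
noncomputable def gram (D : CellDatum R A Λ T) (lam : Λ) : Matrix (T lam) (T lam) R :=
  Matrix.of fun t u => D.coef lam (D.basis ⟨lam, u, u⟩) t u

/-- The product c_{tt} c_{uv}, expanded by the left rule, keeps the second index v, with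
coefficients that do not depend on v. This makes the form well defined. -/
theorem coef_basis [∀ l, DecidableEq (T l)] (D : CellDatum R A Λ T) (lam : Λ)
    (u v t w : T lam) :
    D.coef lam (D.basis ⟨lam, u, v⟩) t w = if w = v then D.gram lam t u else 0 := by
  have key : ∀ v w, D.coef lam (D.basis ⟨lam, u, v⟩) t w =
      if w = v then D.coef lam (D.inv (D.basis ⟨lam, t, t⟩)) u t else 0 := by
    classical
    intro v w
    change D.basis.repr _ _ = _
    have h := D.repr_gtSpan lam (D.mul_basis_sub_mem lam (D.basis ⟨lam, t, t⟩) u v) t w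
    rw [map_sub, Finsupp.sub_apply, sub_eq_zero] at h
    rw [h, map_sum, Finsupp.finsetSum_apply, Finset.sum_eq_single t]
    · by_cases hw : w = v
      · subst hw
        simp
      · simp [hw]
    · intro b _ hb
      simp [hb]
    · simp
  rw [key, gram, Matrix.of_apply, key]
  simp

/-- Matrix form of ⟨xa, y⟩ = ⟨x, ya*⟩: apply the cell representation to the left rule for a c_{uu}.
-/
theorem coef_mul_gram (D : CellDatum R A Λ T) (lam : Λ) (a : A) :
    D.coef lam a * D.gram lam = D.gram lam * (D.coef lam (D.inv a))ᵀ := by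
  classical
  ext t u
  have h := D.coef_of_mem_gtSpan lam (D.mul_basis_sub_mem lam a u u)
  rw [map_sub, sub_eq_zero, coef_mul] at h
  have h2 := congrFun (congrFun h t) u
  simpa [Matrix.mul_apply, Matrix.sum_apply, coef_basis, mul_comm] using h2

theorem form_eq (D : CellDatum R A Λ T) {lam : Λ} (x y : T lam → R) :
    D.form x y = x ᵥ* D.gram lam ⬝ᵥ y := by
  simp only [form, gram, dotProduct, Matrix.vecMul, Matrix.of_apply, Finset.sum_mul]
  rw [Finset.sum_comm]
  exact Finset.sum_congr rfl fun _ _ => Finset.sum_congr rfl fun _ _ => by ring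

theorem form_act (D : CellDatum R A Λ T) {lam : Λ} (x y : T lam → R) (a : A) :
    D.form (D.act x a) y = D.form x (D.act y (D.inv a)) := by
  rw [form_eq, form_eq, act, act, Matrix.vecMul_vecMul, coef_mul_gram, ← Matrix.vecMul_vecMul,
    ← Matrix.dotProduct_mulVec, Matrix.mulVec_transpose]

/-- Modulo the higher ideal m is g* ⊗ g, so it acts with rank at most one. Applied to m_λ, this
produces the scalar in part (2). -/
theorem act_of_sub_mem_gtSpan (D : CellDatum R A Λ T) {lam : Λ} (g : T lam → R) {m : A}
    (hm : m - ∑ s, ∑ t, (g s * g t) • D.basis ⟨lam, s, t⟩ ∈ gtSpan (R := R) D.basis lam)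
    (x : T lam → R) : D.act x m = D.form x g • g := by
  classical
  have h := D.coef_of_mem_gtSpan lam hm
  rw [map_sub, sub_eq_zero] at h
  have h2 : D.coef lam m = Matrix.vecMulVec (D.gram lam *ᵥ g) g := by
    rw [h]
    ext t w
    simp only [map_sum, map_smul, Matrix.sum_apply, Matrix.smul_apply, coef_basis,
      Matrix.vecMulVec_apply, Matrix.mulVec, dotProduct, Finset.sum_mul]
    simp only [smul_eq_mul, mul_ite, mul_zero, Finset.sum_ite_eq, Finset.mem_univ, if_true]
    exact Finset.sum_congr rfl fun _ _ => by ring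
  rw [act, h2, form_eq, Matrix.vecMul_vecMulVec, Matrix.dotProduct_mulVec]

theorem coef_baseChange (S : Type*) [CommRing S] [Algebra R S] (D : CellDatum R A Λ T)
    (lam : Λ) (a : A) :
    (D.baseChange S).coef lam (1 ⊗ₜ[R] a) = (D.coef lam a).map (algebraMap R S) := by
  ext t v
  change (D.basis.baseChange S).repr ((D.basis.baseChange S) _ * _) _ = _
  rw [Module.Basis.baseChange_apply, Algebra.TensorProduct.tmul_mul_tmul, one_mul,
    Module.Basis.baseChange_repr_tmul, Matrix.map_apply, Algebra.smul_def, mul_one]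
  rfl

theorem act_baseChange (S : Type*) [CommRing S] [Algebra R S] (D : CellDatum R A Λ T)
    {lam : Λ} (x : T lam → R) (a : A) :
    (D.baseChange S).act (fun i => algebraMap R S (x i)) (1 ⊗ₜ[R] a) =
      fun i => algebraMap R S (D.act x a i) := by
  ext i
  simp [act, coef_baseChange, Matrix.vecMul, dotProduct]

end CommRing

end CellDatum

end DiagramAlg

/-! ### Semisimple cellular algebras over a field -/

namespace DiagramAlg

theorem SplitSemisimple.isSemisimpleRing {K : Type*} [Field K] {E : Type*} [Ring E] [Algebra K E]
    (h : SplitSemisimple K E) : IsSemisimpleRing E := by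
  obtain ⟨n, k, ⟨e⟩⟩ := h
  exact e.symm.toRingEquiv.isSemisimpleRing

/-- Von Neumann regularity: the left ideal of a is generated by an idempotent e = xa, and right
multiplication by e fixes a. -/
theorem exists_mul_mul_eq_self {E : Type*} [Ring E] [IsSemisimpleRing E] (a : E) :
    ∃ x, a * x * a = a := by
  obtain ⟨e, he, h⟩ := IsSemisimpleRing.ideal_eq_span_idempotent (Ideal.span {a})
  obtain ⟨x, hx⟩ := Ideal.mem_span_singleton'.1 (h ▸ Ideal.mem_span_singleton_self e : e ∈ Ideal.span {a})
  obtain ⟨y, hy⟩ := Ideal.mem_span_singleton'.1 (h ▸ Ideal.mem_span_singleton_self a : a ∈ Ideal.span {e})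
  refine ⟨x, ?_⟩
  rw [mul_assoc, hx, ← hy, mul_assoc, he.eq]

namespace CellDatum

variable {K : Type*} [Field K] {E : Type*} [Ring E] [Algebra K E]
  {Λ : Type*} [PartialOrder Λ] {T : Λ → Type*} [∀ l, Fintype (T l)]

/-- `z` acts as the identity on the cell module of `l` and kills the other ones. -/
def IsCentralIdem (D : CellDatum K E Λ T) (l : Λ) (z : E) : Prop :=
  (∀ x : T l → K, D.act x z = x) ∧ ∀ κ, κ ≠ l → D.coef κ z = 0

theorem IsCentralIdem.coef_self [∀ l, DecidableEq (T l)] {D : CellDatum K E Λ T} {l : Λ} {z : E}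
    (h : D.IsCentralIdem l z) : D.coef l z = 1 := D.coef_eq_one h.1

/-- With zero Gram matrix, c_{ii} x c_{ii} lies in the higher ideal for every x. Regularity would
then put the basis element c_{ii} there. -/
theorem gram_ne_zero [IsSemisimpleRing E] [∀ l, Nonempty (T l)] (D : CellDatum K E Λ T) (l : Λ) : D.gram l ≠ 0 := by
  classical
  intro h
  obtain ⟨i⟩ : Nonempty (T l) := inferInstance
  obtain ⟨x, hx⟩ := exists_mul_mul_eq_self (D.basis ⟨l, i, i⟩)
  have h1 := D.gtSpan_mul_mem l (D.coef_spec l x i i) (D.basis ⟨l, i, i⟩)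
  have h2 : ∀ w, D.basis ⟨l, i, w⟩ * D.basis ⟨l, i, i⟩ ∈ gtSpan (R := K) D.basis l := by
    intro w
    have := D.coef_spec l (D.basis ⟨l, i, i⟩) i w
    simpa [coef_basis, h] using this
  rw [sub_mul, hx, Finset.sum_mul] at h1
  have h3 : D.basis ⟨l, i, i⟩ ∈ gtSpan (R := K) D.basis l := by
    have := add_mem h1 (Submodule.sum_mem (gtSpan (R := K) D.basis l) (t := Finset.univ)
      (f := fun w => D.coef l x i w • D.basis ⟨l, i, w⟩ * D.basis ⟨l, i, i⟩)
      fun w _ => by rw [smul_mul_assoc]; exact Submodule.smul_mem _ _ (h2 w))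
    simpa using this
  have h4 := D.repr_gtSpan l h3 i i
  simp at h4

variable [Finite Λ]

/-- Descending induction on the poset: c_{st} e lies in the higher ideal, which e already kills, so
c_{st} e = c_{st} e e = 0. Thus e annihilates a basis, hence 1. -/
theorem eq_zero_of_idem_of_coef_eq_zero (D : CellDatum K E Λ T) {e : E} (he : e * e = e)
    (h : ∀ l, D.coef l e = 0) : e = 0 := by
  have key : ∀ l s t, D.basis ⟨l, s, t⟩ * e = 0 := by
    intro l
    induction l using (Finite.to_wellFoundedGT (α := Λ)).wf.induction with
    | _ l ih =>
      intro s t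
      have h1 : gtSpan (R := K) D.basis l ≤ LinearMap.ker (LinearMap.mulRight K e) := by
        unfold gtSpan
        rw [Submodule.span_le]
        rintro x ⟨μ, s, t, hμ, rfl⟩
        simpa using ih μ hμ s t
      have h2 := h1 (D.coef_spec l e s t)
      simpa [h, mul_assoc, he] using h2
  have h3 : LinearMap.mulRight K e = 0 := D.basis.ext fun ⟨l, s, t⟩ => by simpa using key l s t
  simpa using LinearMap.congr_fun h3 1

variable [IsSemisimpleRing E]

/-- Regularity reduces the claim to the idempotent xa, where axa = a. -/
theorem eq_zero_of_coef_eq_zero (D : CellDatum K E Λ T) {a : E} (h : ∀ l, D.coef l a = 0) :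
    a = 0 := by
  obtain ⟨x, hx⟩ := exists_mul_mul_eq_self a
  have : x * a = 0 := D.eq_zero_of_idem_of_coef_eq_zero (by rw [← mul_assoc, mul_assoc x, mul_assoc x, hx])
    fun l => by rw [coef_mul, h, mul_zero]
  rw [← hx, mul_assoc, this, mul_zero]

theorem eq_of_coef_eq (D : CellDatum K E Λ T) {a b : E} (h : ∀ l, D.coef l a = D.coef l b) :
    a = b :=
  sub_eq_zero.1 (D.eq_zero_of_coef_eq_zero fun l => by rw [map_sub, h, sub_self])

/-- The joint cell representation is injective, and the cellular basis has exactly as many elements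
as there are matrix entries. -/
theorem exists_coef_eq (D : CellDatum K E Λ T) (M : ∀ l, Matrix (T l) (T l) K) :
    ∃ a, ∀ l, D.coef l a = M l := by
  classical
  have := Fintype.ofFinite Λ
  have hinj : Function.Injective (LinearMap.pi D.coef) :=
    fun a b h => D.eq_of_coef_eq fun l => congrFun h l
  have hfin : Module.Finite K E := Module.Finite.of_basis D.basis
  have hrank : Module.finrank K E = Module.finrank K (∀ l, Matrix (T l) (T l) K) := by
    rw [Module.finrank_eq_card_basis D.basis, Module.finrank_pi_fintype]
    simp [Module.finrank_matrix]
  obtain ⟨a, ha⟩ := (LinearMap.injective_iff_surjective_of_finrank_eq_finrank hrank).1 hinj M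
  exact ⟨a, fun l => congrFun ha l⟩

theorem commute_of_coef (D : CellDatum K E Λ T) {z : E} (h : ∀ l a, D.coef l z * D.coef l a =
    D.coef l a * D.coef l z) (a : E) : z * a = a * z :=
  D.eq_of_coef_eq fun l => by rw [coef_mul, coef_mul, h]

theorem exists_coef_eq_smul_one [∀ l, DecidableEq (T l)] (D : CellDatum K E Λ T) {z : E}
    (hz : z ∈ Set.center E) (l : Λ) : ∃ c : K, D.coef l z = c • 1 := by
  classical
  have h : D.coef l z ∈ Set.range (Matrix.scalar (T l)) := by
    refine Matrix.mem_range_scalar_of_commute_single fun i j _ => ?_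
    obtain ⟨a, ha⟩ := D.exists_coef_eq (Function.update 0 l (Matrix.single i j 1))
    have h1 := ha l
    rw [Function.update_self] at h1
    rw [← h1]
    change _ * _ = _ * _
    rw [← coef_mul, ← coef_mul, (Set.mem_center_iff.1 hz).comm a]
  obtain ⟨c, hc⟩ := h
  exact ⟨c, by rw [← hc, Matrix.smul_one_eq_diagonal]; rfl⟩

theorem IsCentralIdem.mul_of_ne {D : CellDatum K E Λ T} {l κ : Λ} {z w : E}
    (hz : D.IsCentralIdem l z) (hw : D.IsCentralIdem κ w) (h : l ≠ κ) : z * w = 0 := by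
  refine D.eq_zero_of_coef_eq_zero fun ι => ?_
  rw [coef_mul]
  by_cases hι : ι = l
  · subst hι
    rw [hw.2 _ h, mul_zero]
  · rw [hz.2 _ hι, zero_mul]

theorem IsCentralIdem.ext {D : CellDatum K E Λ T} {l : Λ} {z w : E}
    (hz : D.IsCentralIdem l z) (hw : D.IsCentralIdem l w) : z = w := by
  classical
  refine D.eq_of_coef_eq fun κ => ?_
  by_cases hκ : κ = l
  · subst hκ
    rw [hz.coef_self, hw.coef_self]
  · rw [hz.2 κ hκ, hw.2 κ hκ]

theorem IsCentralIdem.comm {D : CellDatum K E Λ T} {l : Λ} {z : E}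
    (hz : D.IsCentralIdem l z) (a : E) : z * a = a * z := by
  classical
  refine D.commute_of_coef (fun κ a => ?_) a
  by_cases hκ : κ = l
  · subst hκ
    rw [hz.coef_self, one_mul, mul_one]
  · rw [hz.2 κ hκ, zero_mul, mul_zero]

theorem IsCentralIdem.mul_self {D : CellDatum K E Λ T} {l : Λ} {z : E}
    (hz : D.IsCentralIdem l z) : z * z = z := by
  classical
  refine D.eq_of_coef_eq fun κ => ?_
  rw [coef_mul]
  by_cases hκ : κ = l
  · subst hκ
    rw [hz.coef_self, one_mul]
  · rw [hz.2 κ hκ, zero_mul]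

theorem sum_isCentralIdem [Fintype Λ] {D : CellDatum K E Λ T} {z : Λ → E}
    (hz : ∀ l, D.IsCentralIdem l (z l)) : ∑ l, z l = 1 := by
  classical
  refine D.eq_of_coef_eq fun κ => ?_
  rw [map_sum, Finset.sum_eq_single κ (fun l _ h => (hz l).2 κ h.symm) (by simp),
    (hz κ).coef_self, coef_one]

variable [∀ l, Nonempty (T l)]

theorem exists_isMinCentralIdem [∀ l, DecidableEq (T l)] (D : CellDatum K E Λ T) (l : Λ) :
    ∃ z, IsMinCentralIdem z ∧ D.IsCentralIdem l z := by
  classical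
  obtain ⟨z, hz⟩ := D.exists_coef_eq (Function.update 0 l 1)
  have h1 : D.coef l z = 1 := by rw [hz, Function.update_self]
  have h0 : ∀ κ, κ ≠ l → D.coef κ z = 0 := fun κ hκ => by
    rw [hz, Function.update_of_ne hκ]; rfl
  have hcases : ∀ κ, κ = l ∨ D.coef κ z = 0 := fun κ => (em _).imp_right (h0 κ)
  refine ⟨z, ⟨?_, ?_, ?_, ?_⟩, fun x => by simp [act, h1], h0⟩
  · rintro rfl
    rw [map_zero] at h1
    exact zero_ne_one h1
  · refine D.eq_of_coef_eq fun κ => ?_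
    rw [coef_mul]
    obtain rfl | h := hcases κ
    · rw [h1, mul_one]
    · rw [h, mul_zero]
  · rw [Semigroup.mem_center_iff]
    refine fun a => (D.commute_of_coef (fun κ a => ?_) a).symm
    obtain rfl | h := hcases κ
    · rw [h1, mul_one, one_mul]
    · rw [h, mul_zero, zero_mul]
  · intro f hf hfc hfz
    obtain ⟨c, hc⟩ := D.exists_coef_eq_smul_one hfc l
    have hf0 : ∀ κ, κ ≠ l → D.coef κ f = 0 := fun κ hκ => by
      rw [← hfz, coef_mul, h0 κ hκ, mul_zero]
    have hcc : c * c = c := by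
      have h2 := D.coef_mul l f f
      rw [hf.eq, hc] at h2
      obtain ⟨i⟩ : Nonempty (T l) := inferInstance
      have h3 := congrFun (congrFun h2 i) i
      simpa [smul_smul] using h3.symm
    rcases IsIdempotentElem.iff_eq_zero_or_one.1 hcc with h | h
    · left
      refine D.eq_zero_of_coef_eq_zero fun κ => ?_
      by_cases hκ : κ = l
      · subst hκ
        rw [hc, h, zero_smul]
      · exact hf0 κ hκ
    · right
      refine D.eq_of_coef_eq fun κ => ?_
      by_cases hκ : κ = l
      · subst hκ
        rw [hc, h, one_smul, h1]
      · rw [hf0 κ hκ, h0 κ hκ]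

/-- Here e is the block idempotent of l. Since z is the identity on that block, ez = e, and
minimality of z forces e = z. This pins down the choice made in `centralIdem`. -/
theorem isCentralIdem_of_isMinCentralIdem (D : CellDatum K E Λ T) {l : Λ} {z : E}
    (hz : IsMinCentralIdem z) (h : ∀ x : T l → K, D.act x z = x) : D.IsCentralIdem l z := by
  classical
  obtain ⟨e, he, he1, he0⟩ := D.exists_isMinCentralIdem l
  have hez : e * z = e := D.eq_of_coef_eq fun κ => by
    rw [coef_mul]
    by_cases hκ : κ = l
    · subst hκ
      rw [D.coef_eq_one h, mul_one]
    · rw [he0 κ hκ, zero_mul]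
  rcases hz.2.2.2 e he.2.1 he.2.2.1 hez with h0 | h0
  · exact (he.1 h0).elim
  · exact h0 ▸ ⟨he1, he0⟩

/-- The involution permutes minimal central idempotents, so z* acts on the cell module of l by a
scalar c. Adjointness gives G = cG for the nonzero Gram matrix G, so c = 1 and z* is the idempotent
of the same block. -/
theorem IsCentralIdem.inv_eq {D : CellDatum K E Λ T} {l : Λ} {z : E}
    (hz : D.IsCentralIdem l z) : D.inv z = z := by
  classical
  obtain ⟨w, hw, hwz⟩ := D.exists_isMinCentralIdem l
  obtain rfl := hz.ext hwz
  have hinj : ∀ {a b}, D.inv a = D.inv b → a = b := fun {a b} h => by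
    rw [← D.inv_inv a, h, D.inv_inv]
  have hc : ∀ {f}, f ∈ Set.center E → D.inv f ∈ Set.center E := fun {f} hf => by
    rw [Semigroup.mem_center_iff] at hf ⊢
    intro g
    refine hinj ?_
    rw [D.inv_mul, D.inv_mul, D.inv_inv, hf]
  have hmin : IsMinCentralIdem (D.inv z) := by
    refine ⟨fun h => hw.1 (hinj (h.trans (map_zero _).symm)), ?_, hc hw.2.2.1, ?_⟩
    · rw [IsIdempotentElem, ← D.inv_mul, hw.2.1.eq]
    · intro f hf hfc hfz
      refine (hw.2.2.2 (D.inv f) ?_ (hc hfc) ?_).imp (fun h => ?_) fun h => ?_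
      · rw [IsIdempotentElem, ← D.inv_mul, hf.eq]
      · rw [← hz.comm, ← D.inv_inv z, ← D.inv_mul, hfz]
      · exact hinj (h.trans (map_zero _).symm)
      · rw [← h, D.inv_inv]
  refine (D.isCentralIdem_of_isMinCentralIdem hmin fun x => ?_).ext hz
  obtain ⟨c, hcz⟩ := D.exists_coef_eq_smul_one hmin.2.2.1 l
  have h := D.coef_mul_gram l z
  rw [hz.coef_self, one_mul, hcz, Matrix.transpose_smul, Matrix.transpose_one, Matrix.mul_smul,
    mul_one] at h
  have hc1 : c = 1 := by
    by_contra hne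
    refine D.gram_ne_zero l ?_
    have h2 : (c - 1) • D.gram l = 0 := by rw [sub_smul, one_smul, ← h, sub_self]
    exact (smul_eq_zero.1 h2).resolve_left (sub_ne_zero.2 hne)
  simp [act, hcz, hc1]

/-- Schur's lemma with an explicit scalar: some a sends y to y_i x for every y, so ψ(x) = ψ(e_i a) =
ψ(e_i) a = ψ(e_i)_i x. -/
theorem exists_smul_of_equivariant (D : CellDatum K E Λ T) {l : Λ} (ψ : (T l → K) →ₗ[K] (T l → K))
    (h : ∀ x a, ψ (D.act x a) = D.act (ψ x) a) : ∃ c : K, ∀ x, ψ x = c • x := by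
  classical
  obtain ⟨i⟩ : Nonempty (T l) := inferInstance
  refine ⟨ψ (Pi.single i 1) i, fun x => ?_⟩
  obtain ⟨a, ha⟩ := D.exists_coef_eq (Function.update 0 l (Matrix.vecMulVec (Pi.single i 1) x))
  have h1 := ha l
  rw [Function.update_self] at h1
  have h2 := h (Pi.single i 1) a
  simpa [act, h1, Matrix.vecMul_vecMulVec] using h2

end CellDatum

end DiagramAlg

/-! ### Clearing denominators -/

namespace DiagramAlg

theorem algebraMap_comp_eq_zero {R : Type*} [CommRing R] {F : Type*} [Field F] [Algebra R F]
    [IsFractionRing R F] {ι : Type*} {x : ι → R}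
    (h : (fun i => algebraMap R F (x i)) = 0) : x = 0 :=
  funext fun i => (map_eq_zero_iff _ (IsFractionRing.injective R F)).1 (congrFun h i)

section Denominators

variable {R : Type*} [CommRing R] [IsDomain R] {F : Type*} [Field F] [Algebra R F]
  [IsFractionRing R F]

theorem exists_smul_eq_one_tmul {M : Type*} [AddCommGroup M] [Module R M] (a : F ⊗[R] M) :
    ∃ b : R, b ≠ 0 ∧ ∃ m : M, algebraMap R F b • a = 1 ⊗ₜ[R] m := by
  induction a using TensorProduct.induction_on with
  | zero => exact ⟨1, one_ne_zero, 0, by simp⟩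
  | tmul f m =>
    obtain ⟨p, q, hq, rfl⟩ := IsFractionRing.div_surjective (A := R) f
    have hq0 : q ≠ 0 := nonZeroDivisors.ne_zero hq
    have hq1 : algebraMap R F q ≠ 0 := (map_ne_zero_iff _ (IsFractionRing.injective R F)).2 hq0
    refine ⟨q, hq0, p • m, ?_⟩
    rw [TensorProduct.smul_tmul', smul_eq_mul, mul_div_cancel₀ _ hq1, ← TensorProduct.smul_tmul,
      Algebra.smul_def, mul_one]
  | add x y hx hy =>
    obtain ⟨b, hb, m, hm⟩ := hx
    obtain ⟨c, hc, n, hn⟩ := hy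
    refine ⟨b * c, mul_ne_zero hb hc, c • m + b • n, ?_⟩
    rw [smul_add, map_mul, mul_comm, mul_smul, hm, mul_comm, mul_smul, hn, TensorProduct.tmul_add,
      TensorProduct.tmul_smul, TensorProduct.tmul_smul, algebraMap_smul, algebraMap_smul]

theorem exists_smul_eq_algebraMap {ι : Type*} [Finite ι] (y : ι → F) :
    ∃ b : R, b ≠ 0 ∧ ∃ x : ι → R, algebraMap R F b • y = fun i => algebraMap R F (x i) := by
  obtain ⟨b, hb⟩ := IsLocalization.exist_integer_multiples_of_finite (nonZeroDivisors R) y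
  choose x hx using hb
  refine ⟨b, nonZeroDivisors.coe_ne_zero b, x, funext fun i => ?_⟩
  rw [hx, Pi.smul_apply, smul_eq_mul, Algebra.smul_def]

end Denominators

/-! ### Gelfand–Zeitlin idempotents and seminormal vectors of the tower -/

namespace DiagramTower

variable {R : Type*} [CommRing R] {F : Type*} [Field F] [Algebra R F]
  {B : Type*} [Ring B] [Algebra R B] {A : ℕ → Subalgebra R B}
  {Λ : ℕ → Type*} [∀ r, PartialOrder (Λ r)]
  {T : ∀ r, Λ r → Type*} [∀ r l, Fintype (T r l)]

section Basic

variable (𝒟 : DiagramTower R F A Λ T)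

theorem isSemisimpleRing (𝒟 : DiagramTower R F A Λ T) (r : ℕ) : IsSemisimpleRing (F ⊗[R] A r) := (𝒟.split r).isSemisimpleRing

@[simp]
theorem inclF_one_tmul {s r : ℕ} (h : s ≤ r) (a : A s) :
    𝒟.inclF h (1 ⊗ₜ[R] a) = 1 ⊗ₜ[R] 𝒟.incl h a := rfl

theorem inclF_inclF {s r k : ℕ} (h : s ≤ r) (h' : r ≤ k) (x : F ⊗[R] A s) :
    𝒟.inclF h' (𝒟.inclF h x) = 𝒟.inclF (h.trans h') x := by
  induction x using TensorProduct.induction_on with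
  | zero => simp
  | tmul f a => rfl
  | add x y hx hy => simp only [map_add, hx, hy]

theorem inclF_refl {s : ℕ} (x : F ⊗[R] A s) : 𝒟.inclF le_rfl x = x := by
  induction x using TensorProduct.induction_on with
  | zero => simp
  | tmul f a => rfl
  | add x y hx hy => simp only [map_add, hx, hy]

theorem inv_inclF_succ {r : ℕ} (x : F ⊗[R] A r) :
    (𝒟.cellF (r + 1)).inv (𝒟.inclF r.le_succ x) = 𝒟.inclF r.le_succ ((𝒟.cellF r).inv x) := by
  induction x using TensorProduct.induction_on with
  | zero => simp
  | tmul f a =>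
    change f ⊗ₜ[R] (𝒟.cell (r + 1)).inv (Subalgebra.inclusion (𝒟.mono r.le_succ) a) = _
    rw [𝒟.inv_compat]
    rfl
  | add x y hx hy => simp only [map_add, hx, hy]

theorem cellF_inv_one_tmul {r : ℕ} (a : A r) :
    (𝒟.cellF r).inv (1 ⊗ₜ[R] a) = 1 ⊗ₜ[R] (𝒟.cell r).inv a := rfl

theorem cellF_act_one_tmul {r : ℕ} {l : Λ r} (x : T r l → R) (a : A r) :
    (𝒟.cellF r).act (fun i => algebraMap R F (x i)) (1 ⊗ₜ[R] a) =
      fun i => algebraMap R F ((𝒟.cell r).act x a i) :=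
  (𝒟.cell r).act_baseChange F x a

/-- The generator of the cell module over the fraction field. -/
noncomputable def genF (r : ℕ) (l : Λ r) : T r l → F := fun i => algebraMap R F (𝒟.gen r l i)

theorem cellF_act_m {r : ℕ} {l : Λ r} (x : T r l → F) :
    (𝒟.cellF r).act x (1 ⊗ₜ[R] 𝒟.m r l) = (𝒟.cellF r).form x (𝒟.genF r l) • 𝒟.genF r l := by
  refine (𝒟.cellF r).act_of_sub_mem_gtSpan _ ?_ x
  have h := (𝒟.cell r).gtSpan_baseChange F l (𝒟.m_lift r l) 1
  rw [TensorProduct.tmul_sub] at h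
  simp only [TensorProduct.tmul_sum] at h
  have key : ∀ s t, (1 : F) ⊗ₜ[R] ((𝒟.gen r l s * 𝒟.gen r l t) • (𝒟.cell r).basis ⟨l, s, t⟩) =
      (𝒟.genF r l s * 𝒟.genF r l t) • (𝒟.cellF r).basis ⟨l, s, t⟩ := fun s t => by
    rw [TensorProduct.tmul_smul, ← algebraMap_smul F, map_mul]
    exact congrArg _ (Module.Basis.baseChange_apply _ _ _).symm
  simp only [key] at h
  exact h

theorem genF_act_one_tmul {r : ℕ} {l : Λ r} (a : A r) :
    (𝒟.cellF r).act (𝒟.genF r l) (1 ⊗ₜ[R] a) =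
      fun i => algebraMap R F ((𝒟.cell r).act (𝒟.gen r l) a i) :=
  𝒟.cellF_act_one_tmul _ _

theorem genF_act_one_tmul_dPath {r : ℕ} {ν : Λ r} (t : 𝒟.Std ν) :
    (𝒟.cellF r).act (𝒟.genF r ν) (1 ⊗ₜ[R] 𝒟.dPath t.1) =
      fun i => algebraMap R F (𝒟.murphy t i) :=
  𝒟.cellF_act_one_tmul _ _

theorem seminormal_eq {r : ℕ} {ν : Λ r} (t : 𝒟.Std ν) :
    𝒟.seminormal t =
      (𝒟.cellF r).act (𝒟.genF r ν) ((1 ⊗ₜ[R] 𝒟.dPath t.1) * 𝒟.gz t.1) := by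
  rw [CellDatum.act_mul, genF_act_one_tmul_dPath]
  rfl

/-- The cellular basis of A_0 = R has one element. Distinct paths therefore differ at a level i ≥ 1,
where F_t does have a factor. -/
theorem subsingleton_zero [IsDomain R] [∀ r, Finite (Λ r)] [∀ r l, Nonempty (T r l)]
    (𝒟 : DiagramTower R F A Λ T) :
    Subsingleton (Λ 0) := by
  have e : R ≃ₗ[R] A 0 := LinearEquiv.ofBijective (Algebra.linearMap R (A 0)) 𝒟.zero
  have h := Module.finrank_eq_nat_card_basis (𝒟.cell 0).basis
  rw [← e.finrank_eq, Module.finrank_self] at h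
  have := (Nat.card_eq_one_iff_unique.1 h.symm).1
  refine ⟨fun a b => ?_⟩
  obtain ⟨i⟩ : Nonempty (T 0 a) := inferInstance
  obtain ⟨j⟩ : Nonempty (T 0 b) := inferInstance
  exact congrArg Sigma.fst (Subsingleton.elim
    (⟨a, i, i⟩ : Σ l : Λ 0, T 0 l × T 0 l) ⟨b, j, j⟩)

end Basic

section Idempotents

variable [∀ r, Finite (Λ r)] [∀ r l, Nonempty (T r l)] (𝒟 : DiagramTower R F A Λ T)

theorem isCentralIdem_centralIdem {r : ℕ} (l : Λ r) :
    (𝒟.cellF r).IsCentralIdem l (𝒟.centralIdem l) := by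
  classical
  have := 𝒟.isSemisimpleRing r
  obtain ⟨z, hz, hzl⟩ := (𝒟.cellF r).exists_isMinCentralIdem l
  have h := Classical.epsilon_spec (p := fun z : F ⊗[R] A r =>
    IsMinCentralIdem z ∧ ∀ x : T r l → F, (𝒟.cellF r).act x z = x) ⟨z, hz, hzl.1⟩
  exact (𝒟.cellF r).isCentralIdem_of_isMinCentralIdem h.1 h.2

theorem centralIdem_comm {r : ℕ} (l : Λ r) (a : F ⊗[R] A r) :
    𝒟.centralIdem l * a = a * 𝒟.centralIdem l :=
  have := 𝒟.isSemisimpleRing r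
  (𝒟.isCentralIdem_centralIdem l).comm a

theorem centralIdem_mul_self {r : ℕ} (l : Λ r) :
    𝒟.centralIdem l * 𝒟.centralIdem l = 𝒟.centralIdem l :=
  have := 𝒟.isSemisimpleRing r
  (𝒟.isCentralIdem_centralIdem l).mul_self

theorem centralIdem_mul_of_ne {r : ℕ} {l κ : Λ r} (h : l ≠ κ) :
    𝒟.centralIdem l * 𝒟.centralIdem κ = 0 :=
  have := 𝒟.isSemisimpleRing r
  (𝒟.isCentralIdem_centralIdem l).mul_of_ne (𝒟.isCentralIdem_centralIdem κ) h

theorem inv_centralIdem {r : ℕ} (l : Λ r) :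
    (𝒟.cellF r).inv (𝒟.centralIdem l) = 𝒟.centralIdem l :=
  have := 𝒟.isSemisimpleRing r
  (𝒟.isCentralIdem_centralIdem l).inv_eq

theorem act_centralIdem_self {r : ℕ} {l : Λ r} (x : T r l → F) :
    (𝒟.cellF r).act x (𝒟.centralIdem l) = x :=
  (𝒟.isCentralIdem_centralIdem l).1 x

theorem act_centralIdem_of_ne {r : ℕ} {l κ : Λ r} (h : l ≠ κ) (x : T r l → F) :
    (𝒟.cellF r).act x (𝒟.centralIdem κ) = 0 := by
  rw [CellDatum.act, (𝒟.isCentralIdem_centralIdem κ).2 l h, Matrix.vecMul_zero]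

theorem sum_centralIdem (r : ℕ) [Fintype (Λ r)] :
    ∑ l : Λ r, 𝒟.centralIdem l = 1 :=
  have := 𝒟.isSemisimpleRing r
  CellDatum.sum_isCentralIdem 𝒟.isCentralIdem_centralIdem

theorem gzUpTo_mul_self {r : ℕ} (t : 𝒟.Path 0 r) (k : ℕ) (h : k ≤ r) :
    𝒟.gzUpTo t k h * 𝒟.gzUpTo t k h = 𝒟.gzUpTo t k h := by
  induction k with
  | zero => simp [gzUpTo]
  | succ k ih =>
    rw [gzUpTo, mul_assoc, ← mul_assoc (𝒟.centralIdem _), centralIdem_comm, mul_assoc,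
      centralIdem_mul_self, ← mul_assoc, ← map_mul, ih]

theorem gzUpTo_mul_of_ne {r : ℕ} (t u : 𝒟.Path 0 r) (k : ℕ) (h : k ≤ r) (i : ℕ) (hi : 1 ≤ i)
    (hik : i ≤ k) (hne : t.at i i.zero_le (hik.trans h) ≠ u.at i i.zero_le (hik.trans h)) :
    𝒟.gzUpTo t k h * 𝒟.gzUpTo u k h = 0 := by
  induction k with
  | zero => omega
  | succ k ih =>
    rw [gzUpTo, gzUpTo, mul_assoc, ← mul_assoc (𝒟.centralIdem _), centralIdem_comm, mul_assoc]
    obtain hk | rfl := Nat.le_succ_iff.1 hik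
    · rw [← mul_assoc, ← map_mul, ih _ hk hne, map_zero, zero_mul]
    · rw [centralIdem_mul_of_ne _ hne, mul_zero, mul_zero]

theorem inv_gzUpTo {r : ℕ} (t : 𝒟.Path 0 r) (k : ℕ) (h : k ≤ r) :
    (𝒟.cellF k).inv (𝒟.gzUpTo t k h) = 𝒟.gzUpTo t k h := by
  induction k with
  | zero => exact (𝒟.cellF 0).inv_one
  | succ k ih =>
    rw [gzUpTo, (𝒟.cellF (k + 1)).inv_mul, inv_centralIdem, inv_inclF_succ, ih, centralIdem_comm]

theorem centralIdem_mul_gz {r : ℕ} (hr : 1 ≤ r) {ν : Λ r} (t : 𝒟.Std ν) :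
    𝒟.centralIdem ν * 𝒟.gz t.1 = 𝒟.gz t.1 := by
  obtain ⟨t, rfl⟩ := t
  obtain ⟨r, rfl⟩ := Nat.exists_eq_succ_of_ne_zero (Nat.one_le_iff_ne_zero.1 hr)
  rw [centralIdem_comm]
  dsimp only
  rw [gz, gzUpTo, mul_assoc, centralIdem_mul_self]

theorem seminormal_act_gz {r : ℕ} {ν : Λ r} (t : 𝒟.Std ν) :
    (𝒟.cellF r).act (𝒟.seminormal t) (𝒟.gz t.1) = 𝒟.seminormal t := by
  rw [seminormal, ← CellDatum.act_mul, gz, gzUpTo_mul_self]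

/-- Since f_t F_t = f_t, the element d_t^* m takes f_t to ⟨f_t d_t^*, δ⟩ δ = ⟨f_t, m_t⟩ δ. As F_t^*
= F_t, the scalar is ⟨f_t, f_t⟩; then δ d_v F_v = f_v. -/
theorem seminormal_act_seminormalCell {r : ℕ} {ν : Λ r} (t v : 𝒟.Std ν) :
    (𝒟.cellF r).act (𝒟.seminormal t) (𝒟.seminormalCell t v) =
      (𝒟.cellF r).form (𝒟.seminormal t) (𝒟.seminormal t) • 𝒟.seminormal v := by
  have h : (1 : F) ⊗ₜ[R] 𝒟.murphyCell t v =
      (𝒟.cellF r).inv (1 ⊗ₜ[R] 𝒟.dPath t.1) * (1 ⊗ₜ[R] 𝒟.m r ν) * (1 ⊗ₜ[R] 𝒟.dPath v.1) := by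
    simp only [cellF_inv_one_tmul, Algebra.TensorProduct.tmul_mul_tmul, one_mul, murphyCell]
  rw [seminormalCell, h]
  simp only [CellDatum.act_mul]
  rw [seminormal_act_gz, cellF_act_m, CellDatum.form_act, CellDatum.inv_inv,
    genF_act_one_tmul_dPath]
  have h2 : (𝒟.cellF r).form (𝒟.seminormal t) (fun i => algebraMap R F (𝒟.murphy t i)) =
      (𝒟.cellF r).form (𝒟.seminormal t) (𝒟.seminormal t) := by
    conv_lhs => rw [← seminormal_act_gz, CellDatum.form_act, gz, inv_gzUpTo]
    rfl
  rw [h2, CellDatum.smul_act, genF_act_one_tmul_dPath, CellDatum.smul_act]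
  rfl

theorem seminormal_act_seminormalCell_of_ne [IsDomain R] {r : ℕ} (hr : 1 ≤ r) {ν μ : Λ r}
    (t : 𝒟.Std ν) (u v : 𝒟.Std μ) (h : μ ≠ ν ∨ u.1 ≠ t.1) :
    (𝒟.cellF r).act (𝒟.seminormal t) (𝒟.seminormalCell u v) = 0 := by
  by_cases hμ : μ = ν
  · have hne : u.1 ≠ t.1 := h.resolve_left (not_not.2 hμ)
    have hex : ∃ (i : ℕ) (hi : i ≤ r), t.1.at i i.zero_le hi ≠ u.1.at i i.zero_le hi := by
      by_contra! hall
      exact hne (Subtype.ext (funext fun i => (hall i.1 i.2.2).symm))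
    obtain ⟨i, hi, hti⟩ := hex
    have hi1 : 1 ≤ i := by
      by_contra hi0
      obtain rfl : i = 0 := by omega
      have := 𝒟.subsingleton_zero
      exact hti (Subsingleton.elim _ _)
    rw [seminormalCell, ← seminormal_act_gz, ← CellDatum.act_mul, ← mul_assoc, ← mul_assoc, gz, gz,
      gzUpTo_mul_of_ne _ _ _ _ _ i hi1 hi hti, zero_mul, zero_mul, CellDatum.act,
      map_zero, Matrix.vecMul_zero]
  · rw [seminormalCell, ← 𝒟.centralIdem_mul_gz hr u]
    simp only [CellDatum.act_mul]
    simp only [act_centralIdem_of_ne _ (Ne.symm hμ), CellDatum.zero_act]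

end Idempotents

end DiagramTower

end DiagramAlg

/-! ### Branching: edges as embeddings of cell modules over the fraction field -/

namespace DiagramAlg

namespace DiagramTower

variable {R : Type*} [CommRing R] {F : Type*} [Field F] [Algebra R F]
  {B : Type*} [Ring B] [Algebra R B] {A : ℕ → Subalgebra R B}
  {Λ : ℕ → Type*} [∀ r, PartialOrder (Λ r)]
  {T : ∀ r, Λ r → Type*} [∀ r l, Fintype (T r l)]

/-- `δ(μ) d_{κ → μ}` in the cell module over the fraction field. -/
noncomputable def branchGen (𝒟 : DiagramTower R F A Λ T) {r : ℕ} (κ : Λ r) (μ : Λ (r + 1)) : T (r + 1) μ → F :=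
  fun i => algebraMap R F ((𝒟.cell (r + 1)).act (𝒟.gen (r + 1) μ) (𝒟.d r κ μ) i)

theorem branchGen_act_one_tmul (𝒟 : DiagramTower R F A Λ T) {r : ℕ} (κ : Λ r) (μ : Λ (r + 1)) (a : A (r + 1)) :
    (𝒟.cellF (r + 1)).act (𝒟.branchGen κ μ) (1 ⊗ₜ[R] a) = fun i => algebraMap R F
      ((𝒟.cell (r + 1)).act ((𝒟.cell (r + 1)).act (𝒟.gen (r + 1) μ) (𝒟.d r κ μ)) a i) :=
  𝒟.cellF_act_one_tmul _ _

variable [IsDomain R] [IsFractionRing R F]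

theorem exists_genF_act_eq (𝒟 : DiagramTower R F A Λ T) {r : ℕ} {l : Λ r} (y : T r l → F) :
    ∃ a, (𝒟.cellF r).act (𝒟.genF r l) a = y := by
  obtain ⟨b, hb, x, hx⟩ := exists_smul_eq_algebraMap (R := R) y
  have hb' : algebraMap R F b ≠ 0 := (map_ne_zero_iff _ (IsFractionRing.injective R F)).2 hb
  obtain ⟨a, ha⟩ := 𝒟.gen_cyclic r l x
  refine ⟨(algebraMap R F b)⁻¹ • (1 ⊗ₜ[R] a), ?_⟩
  rw [CellDatum.act_smul, genF_act_one_tmul, ha, ← hx, inv_smul_smul₀ hb']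

variable [∀ r, Finite (Λ r)] [∀ r l, Nonempty (T r l)] (𝒟 : DiagramTower R F A Λ T)

/-- The component at `κ` of an element of the `i`-th filtration layer is controlled by the
occurrences of `κ` among the first `i` labels. -/
theorem act_centralIdem_mem_of_mem_filtration {r : ℕ} {μ : Λ (r + 1)} (κ : Λ r)
    (N : Submodule F (T (r + 1) μ → F)) (i : ℕ) (hi : i < (𝒟.fil r μ).len + 1)
    (hN : ∀ j : Fin (𝒟.fil r μ).len, j.val < i → (𝒟.fil r μ).label j = κ → ∀ a : F ⊗[R] A r,
      (𝒟.cellF (r + 1)).act (𝒟.branchGen κ μ)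
        (𝒟.inclF r.le_succ (𝒟.centralIdem κ * a)) ∈ N)
    (x : T (r + 1) μ → R) (hx : x ∈ (𝒟.fil r μ).M ⟨i, hi⟩) :
    (𝒟.cellF (r + 1)).act (fun k => algebraMap R F (x k))
      (𝒟.inclF r.le_succ (𝒟.centralIdem κ)) ∈ N := by
  induction i generalizing x with
  | zero =>
    have h0 : x ∈ (𝒟.fil r μ).M 0 := hx
    rw [(𝒟.fil r μ).bot, Submodule.mem_bot] at h0
    subst h0
    have : (fun k => algebraMap R F ((0 : T (r + 1) μ → R) k)) = 0 := by ext; simp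
    rw [this, CellDatum.zero_act]
    exact N.zero_mem
  | succ i ih =>
    let j : Fin (𝒟.fil r μ).len := ⟨i, by omega⟩
    have hx' : x ∈ (𝒟.fil r μ).M j.succ := hx
    have ih' := ih (by omega) fun j hj => hN j (by omega)
    by_cases hκ : (𝒟.fil r μ).label j = κ
    -- The class of x in this layer is δ(κ)a, so x differs from δ(μ) d a by an element of the
    -- previous layer.
    · obtain ⟨a, ha⟩ := 𝒟.gen_cyclic r _ ((𝒟.fil r μ).quot j ⟨x, hx'⟩)
      obtain ⟨hd, hd'⟩ := 𝒟.d_spec r μ j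
      have h1 := (𝒟.fil r μ).quot_act j ⟨_, hd⟩ a
      rw [hd', ha] at h1
      have h2 := ((𝒟.fil r μ).quot_ker j (⟨x, hx'⟩ - ⟨_, (𝒟.fil r μ).stable _ _ hd a⟩)).1
        (by rw [map_sub]; exact sub_eq_zero.2 h1.symm)
      have h3 := ih' _ h2
      have h4 := hN j (Nat.lt_succ_self i) hκ (1 ⊗ₜ[R] a)
      rw [centralIdem_comm, map_mul, CellDatum.act_mul, inclF_one_tmul, branchGen_act_one_tmul] at h4
      have h5 := add_mem h3 h4
      rw [← CellDatum.add_act] at h5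
      convert h5 using 2
      ext k
      subst hκ
      simp only [Pi.add_apply, ← map_add]
      refine congrArg _ ?_
      exact (sub_add_cancel (x k) _).symm
    -- Here z_κ kills the quotient, so its integral multiple a = b z_κ moves x into the previous
    -- layer. A second application of z_κ only leaves the scalar b to cancel.
    · obtain ⟨b, hb, a, ha⟩ := exists_smul_eq_one_tmul (𝒟.centralIdem κ)
      have hb' : algebraMap R F b ≠ 0 := (map_ne_zero_iff _ (IsFractionRing.injective R F)).2 hb
      have h1 : (𝒟.fil r μ).quot j ⟨_, (𝒟.fil r μ).stable _ _ hx' a⟩ = 0 := by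
        rw [(𝒟.fil r μ).quot_act j ⟨x, hx'⟩ a]
        refine algebraMap_comp_eq_zero (F := F) ?_
        rw [← cellF_act_one_tmul, ← ha, CellDatum.act_smul, act_centralIdem_of_ne _ hκ, smul_zero]
      have h2 := ih' _ (((𝒟.fil r μ).quot_ker j _).1 h1)
      have h3 : (fun k => algebraMap R F ((𝒟.cell (r + 1)).act x
          (Subalgebra.inclusion (𝒟.mono r.le_succ) a) k)) =
          (𝒟.cellF (r + 1)).act (fun k => algebraMap R F (x k))
            (𝒟.inclF r.le_succ (algebraMap R F b • 𝒟.centralIdem κ)) := by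
        rw [ha, inclF_one_tmul, cellF_act_one_tmul]
        rfl
      dsimp only at h2
      rw [h3, ← CellDatum.act_mul, ← map_mul, smul_mul_assoc, centralIdem_mul_self, map_smul,
        CellDatum.act_smul] at h2
      exact (N.smul_mem_iff hb').1 h2

/-- Taken with N = ⊥ for a non-edge, and with N the image of `branch` for an edge. -/
theorem act_centralIdem_mem {r : ℕ} {μ : Λ (r + 1)} (κ : Λ r)
    (N : Submodule F (T (r + 1) μ → F))
    (hN : 𝒟.Edge κ μ → ∀ a : F ⊗[R] A r, (𝒟.cellF (r + 1)).act (𝒟.branchGen κ μ)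
        (𝒟.inclF r.le_succ (𝒟.centralIdem κ * a)) ∈ N) (y : T (r + 1) μ → F) :
    (𝒟.cellF (r + 1)).act y (𝒟.inclF r.le_succ (𝒟.centralIdem κ)) ∈ N := by
  obtain ⟨b, hb, x, hx⟩ := exists_smul_eq_algebraMap (R := R) y
  have hb' : algebraMap R F b ≠ 0 := (map_ne_zero_iff _ (IsFractionRing.injective R F)).2 hb
  have h := 𝒟.act_centralIdem_mem_of_mem_filtration κ N _ (Nat.lt_succ_self _)
    (fun j _ hj => hN ⟨j, hj⟩) x (by
      have : (𝒟.fil r μ).M (Fin.last _) = ⊤ := (𝒟.fil r μ).top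
      change x ∈ (𝒟.fil r μ).M (Fin.last _)
      rw [this]
      trivial)
  rw [← hx, CellDatum.smul_act] at h
  exact (N.smul_mem_iff hb').1 h

/-- The restriction to `A_r^F` of the cell module of `μ` has no component at a non-edge. -/
theorem act_centralIdem_of_not_edge {r : ℕ} {μ : Λ (r + 1)} {κ : Λ r} (h : ¬ 𝒟.Edge κ μ)
    (y : T (r + 1) μ → F) :
    (𝒟.cellF (r + 1)).act y (𝒟.inclF r.le_succ (𝒟.centralIdem κ)) = 0 :=
  (Submodule.mem_bot F).1 (𝒟.act_centralIdem_mem κ ⊥ (fun he => (h he).elim) y)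

/-- An edge `κ → μ` embeds the cell module of `κ` over `F` into the restriction of that of `μ`. -/
theorem exists_branch {r : ℕ} {μ : Λ (r + 1)} {κ : Λ r} (h : 𝒟.Edge κ μ) :
    ∃ φ : (T r κ → F) →ₗ[F] (T (r + 1) μ → F), ∀ a, φ ((𝒟.cellF r).act (𝒟.genF r κ) a) =
      (𝒟.cellF (r + 1)).act (𝒟.branchGen κ μ)
        (𝒟.inclF r.le_succ (𝒟.centralIdem κ * a)) := by
  let f : F ⊗[R] A r →ₗ[F] (T r κ → F) := (𝒟.cellF r).actₗ κ (𝒟.genF r κ)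
  let g : F ⊗[R] A r →ₗ[F] (T (r + 1) μ → F) :=
    (𝒟.cellF (r + 1)).actₗ μ (𝒟.branchGen κ μ) ∘ₗ (𝒟.inclF r.le_succ).toLinearMap ∘ₗ
      LinearMap.mulLeft F (𝒟.centralIdem κ)
  have hf : Function.Surjective f := 𝒟.exists_genF_act_eq
  -- Well-definedness of δ(κ)a ↦ δ(μ) d z_κ a. If δ(κ)a = 0, a multiple of δ(μ) d a lies in the
  -- layer below j. All labels there are strictly larger than κ, so z_κ kills it.
  have hfg : ∀ a, f a = 0 → g a = 0 := by
    intro a ha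
    obtain ⟨j, rfl⟩ := h
    obtain ⟨b, hb, a₀, hab⟩ := exists_smul_eq_one_tmul a
    have hb' : algebraMap R F b ≠ 0 := (map_ne_zero_iff _ (IsFractionRing.injective R F)).2 hb
    obtain ⟨hd, hd'⟩ := 𝒟.d_spec r μ j
    have h1 : (𝒟.fil r μ).quot j ⟨_, (𝒟.fil r μ).stable _ _ hd a₀⟩ = 0 := by
      rw [(𝒟.fil r μ).quot_act j ⟨_, hd⟩ a₀, hd']
      refine algebraMap_comp_eq_zero (F := F) ?_
      rw [← cellF_act_one_tmul, ← hab, CellDatum.act_smul]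
      exact smul_eq_zero_of_right _ ha
    have h2 := 𝒟.act_centralIdem_mem_of_mem_filtration ((𝒟.fil r μ).label j) ⊥ j.val
      (by omega) (fun i hi hij => ((𝒟.fil r μ).order i j hi).ne' hij |>.elim) _
      (((𝒟.fil r μ).quot_ker j _).1 h1)
    have h3 : (fun k => algebraMap R F ((𝒟.cell (r + 1)).act
          ((𝒟.cell (r + 1)).act (𝒟.gen (r + 1) μ) (𝒟.d r ((𝒟.fil r μ).label j) μ))
          (Subalgebra.inclusion (𝒟.mono r.le_succ) a₀) k)) =
          (𝒟.cellF (r + 1)).act (𝒟.branchGen ((𝒟.fil r μ).label j) μ)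
            (𝒟.inclF r.le_succ (algebraMap R F b • a)) := by
      rw [hab, inclF_one_tmul, branchGen_act_one_tmul]
      rfl
    dsimp only at h2
    rw [h3, ← CellDatum.act_mul, ← map_mul, ← centralIdem_comm, mul_smul_comm, map_smul,
      CellDatum.act_smul, Submodule.mem_bot] at h2
    exact (smul_eq_zero.1 h2).resolve_left hb'
  obtain ⟨s, hs⟩ := f.exists_rightInverse_of_surjective (LinearMap.range_eq_top.2 hf)
  refine ⟨g ∘ₗ s, fun a => ?_⟩
  have h1 := hfg (s (f a) - a) (by
    rw [map_sub, ← LinearMap.comp_apply, hs, LinearMap.id_apply, sub_self])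
  rw [map_sub] at h1
  exact sub_eq_zero.1 h1

/-- The embedding of `exists_branch`. -/
noncomputable def branch {r : ℕ} {μ : Λ (r + 1)} {κ : Λ r} (h : 𝒟.Edge κ μ) :
    (T r κ → F) →ₗ[F] (T (r + 1) μ → F) :=
  (𝒟.exists_branch h).choose

theorem branch_genF_act {r : ℕ} {μ : Λ (r + 1)} {κ : Λ r} (h : 𝒟.Edge κ μ) (a : F ⊗[R] A r) :
    𝒟.branch h ((𝒟.cellF r).act (𝒟.genF r κ) a) =
      (𝒟.cellF (r + 1)).act (𝒟.branchGen κ μ)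
        (𝒟.inclF r.le_succ (𝒟.centralIdem κ * a)) :=
  (𝒟.exists_branch h).choose_spec a

theorem branch_act {r : ℕ} {μ : Λ (r + 1)} {κ : Λ r} (h : 𝒟.Edge κ μ) (y : T r κ → F)
    (a : F ⊗[R] A r) :
    𝒟.branch h ((𝒟.cellF r).act y a) =
      (𝒟.cellF (r + 1)).act (𝒟.branch h y) (𝒟.inclF r.le_succ a) := by
  obtain ⟨c, rfl⟩ := 𝒟.exists_genF_act_eq y
  rw [← CellDatum.act_mul, branch_genF_act, branch_genF_act, ← CellDatum.act_mul, ← map_mul,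
    mul_assoc]

/-- If δ(μ) d z_κ c = 0, its class in the layer labelled κ vanishes too. After clearing denominators
that class is a nonzero multiple of δ(κ) z_κ c = δ(κ)c. -/
theorem branch_injective {r : ℕ} {μ : Λ (r + 1)} {κ : Λ r} (h : 𝒟.Edge κ μ) :
    Function.Injective (𝒟.branch h) := by
  rw [injective_iff_map_eq_zero]
  intro y hy
  obtain ⟨c, rfl⟩ := 𝒟.exists_genF_act_eq y
  rw [branch_genF_act] at hy
  obtain ⟨j, rfl⟩ := id h
  obtain ⟨b, hb, a, ha⟩ := exists_smul_eq_one_tmul (𝒟.centralIdem ((𝒟.fil r μ).label j) * c)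
  have hb' : algebraMap R F b ≠ 0 := (map_ne_zero_iff _ (IsFractionRing.injective R F)).2 hb
  obtain ⟨hd, hd'⟩ := 𝒟.d_spec r μ j
  have h1 := (𝒟.fil r μ).quot_act j ⟨_, hd⟩ a
  have h2 : (𝒟.cell (r + 1)).act
      ((𝒟.cell (r + 1)).act (𝒟.gen (r + 1) μ) (𝒟.d r ((𝒟.fil r μ).label j) μ))
      (Subalgebra.inclusion (𝒟.mono r.le_succ) a) = 0 := by
    refine algebraMap_comp_eq_zero (F := F) ?_
    rw [← cellF_act_one_tmul]
    change (𝒟.cellF (r + 1)).act (𝒟.branchGen _ μ) (𝒟.inclF r.le_succ (1 ⊗ₜ[R] a)) = 0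
    rw [← ha, map_smul, CellDatum.act_smul, hy, smul_zero]
  have h3 : (⟨_, (𝒟.fil r μ).stable _ _ hd a⟩ : (𝒟.fil r μ).M j.succ) = 0 := Subtype.ext h2
  rw [h3, map_zero, hd'] at h1
  have h4 : (𝒟.cellF r).act (𝒟.genF r ((𝒟.fil r μ).label j)) (1 ⊗ₜ[R] a) = 0 := by
    rw [genF_act_one_tmul, ← h1]
    ext
    simp
  rw [← ha, CellDatum.act_smul, CellDatum.act_mul, act_centralIdem_self] at h4
  exact (smul_eq_zero.1 h4).resolve_left hb'

/-- The projection of the restriction of the cell module of `μ` to that of `κ`, for an edge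
`κ → μ`. -/
theorem exists_branch_projection {r : ℕ} {μ : Λ (r + 1)} {κ : Λ r} (h : 𝒟.Edge κ μ) :
    ∃ π : (T (r + 1) μ → F) →ₗ[F] (T r κ → F),
      (∀ y, 𝒟.branch h (π y) =
        (𝒟.cellF (r + 1)).act y (𝒟.inclF r.le_succ (𝒟.centralIdem κ))) ∧
      ∀ y a, π ((𝒟.cellF (r + 1)).act y (𝒟.inclF r.le_succ a)) = (𝒟.cellF r).act (π y) a := by
  obtain ⟨g, hg⟩ := (𝒟.branch h).exists_leftInverse_of_injective
    (LinearMap.ker_eq_bot.2 (𝒟.branch_injective h))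
  -- The z_κ-component is contained in the image of `branch`, so a linear left inverse of `branch`
  -- is a true inverse on it.
  have key : ∀ y, 𝒟.branch h
      (g ((𝒟.cellF (r + 1)).act y (𝒟.inclF r.le_succ (𝒟.centralIdem κ)))) =
      (𝒟.cellF (r + 1)).act y (𝒟.inclF r.le_succ (𝒟.centralIdem κ)) := by
    intro y
    obtain ⟨w, hw⟩ := 𝒟.act_centralIdem_mem κ (LinearMap.range (𝒟.branch h))
      (fun _ a => ⟨_, 𝒟.branch_genF_act h a⟩) y
    rw [← hw, ← LinearMap.comp_apply g, hg, LinearMap.id_apply]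
  refine ⟨g ∘ₗ ((𝒟.cellF (r + 1)).actₗ μ).flip (𝒟.inclF r.le_succ (𝒟.centralIdem κ)),
    key, fun y a => 𝒟.branch_injective h ?_⟩
  rw [branch_act]
  change 𝒟.branch h (g _) = (𝒟.cellF (r + 1)).act (𝒟.branch h (g _)) _
  rw [LinearMap.flip_apply, LinearMap.flip_apply, CellDatum.actₗ_apply, CellDatum.actₗ_apply, key,
    key, ← CellDatum.act_mul, ← CellDatum.act_mul, ← map_mul, ← map_mul, centralIdem_comm]

end DiagramTower

end DiagramAlg

/-! ### Paths, and homomorphisms between cell modules -/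

namespace DiagramAlg

namespace DiagramTower

variable {R : Type*} [CommRing R] {F : Type*} [Field F] [Algebra R F]
  {B : Type*} [Ring B] [Algebra R B] {A : ℕ → Subalgebra R B}
  {Λ : ℕ → Type*} [∀ r, PartialOrder (Λ r)]
  {T : ∀ r, Λ r → Type*} [∀ r l, Fintype (T r l)]

section Paths

variable {𝒟 : DiagramTower R F A Λ T}

theorem Path.ext_at {s r : ℕ} {t u : 𝒟.Path s r} (h : ∀ i h₁ h₂, t.at i h₁ h₂ = u.at i h₁ h₂) :
    t = u :=
  Subtype.ext (funext fun i => h i.1 i.2.1 i.2.2)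

theorem Path.concat_at_of_le {q s r : ℕ} (a : 𝒟.Path q s) (b : 𝒟.Path s r)
    (hqs : q ≤ s) (hsr : s ≤ r) (h : a.at s hqs le_rfl = b.at s le_rfl hsr) (i : ℕ) (h₁ : q ≤ i)
    (h₂ : i ≤ r) (hi : i ≤ s) : (a.concat b hqs hsr h).at i h₁ h₂ = a.at i h₁ hi :=
  dif_pos hi

theorem Path.concat_at_of_lt {q s r : ℕ} (a : 𝒟.Path q s) (b : 𝒟.Path s r)
    (hqs : q ≤ s) (hsr : s ≤ r) (h : a.at s hqs le_rfl = b.at s le_rfl hsr) (i : ℕ) (h₁ : q ≤ i)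
    (h₂ : i ≤ r) (hi : s < i) : (a.concat b hqs hsr h).at i h₁ h₂ = b.at i hi.le h₂ :=
  dif_neg (not_le.2 hi)

theorem Std.comp_at_of_le {s r : ℕ} {hsr : s ≤ r} {l : Λ s} {ν : Λ r}
    (p : 𝒟.Std l) (q : 𝒟.SkewStd hsr l ν) (i : ℕ) (h₂ : i ≤ r) (hi : i ≤ s) :
    (p.comp q).1.at i i.zero_le h₂ = p.1.at i i.zero_le hi :=
  Path.concat_at_of_le p.1 q.1 s.zero_le hsr (p.2.trans q.2.1.symm) i _ h₂ hi

theorem Std.comp_at_of_lt {s r : ℕ} {hsr : s ≤ r} {l : Λ s} {ν : Λ r}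
    (p : 𝒟.Std l) (q : 𝒟.SkewStd hsr l ν) (i : ℕ) (h₂ : i ≤ r) (hi : s < i) :
    (p.comp q).1.at i i.zero_le h₂ = q.1.at i hi.le h₂ :=
  Path.concat_at_of_lt p.1 q.1 s.zero_le hsr (p.2.trans q.2.1.symm) i _ h₂ hi

/-- Extension of a path by an edge. -/
def Path.snoc {s r : ℕ} (hsr : s ≤ r) (q : 𝒟.Path s r) (μ : Λ (r + 1))
    (h : 𝒟.Edge (q.at r hsr le_rfl) μ) : 𝒟.Path s (r + 1) :=
  ⟨fun i => if hi : i.1 ≤ r then q.at i i.2.1 hi else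
    (show r + 1 = i.1 by have := i.2.2; omega) ▸ μ, by
    intro i h₁ h₂
    obtain hi | rfl := Nat.lt_or_eq_of_le (Nat.le_of_succ_le_succ h₂)
    · have h3 : i ≤ r := hi.le
      have h4 : i + 1 ≤ r := hi
      simp only [h3, h4, dite_true]
      exact q.2 i h₁ h4
    · have h4 : ¬ i + 1 ≤ i := by omega
      simp only [le_refl, h4, dite_true, dite_false]
      exact h⟩

theorem Path.snoc_at_of_le {s r : ℕ} (hsr : s ≤ r) (q : 𝒟.Path s r) (μ : Λ (r + 1))
    (h : 𝒟.Edge (q.at r hsr le_rfl) μ) (i : ℕ) (h₁ : s ≤ i) (h₂ : i ≤ r + 1) (hi : i ≤ r) :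
    (q.snoc hsr μ h).at i h₁ h₂ = q.at i h₁ hi :=
  dif_pos hi

theorem Path.snoc_at_last {s r : ℕ} (hsr : s ≤ r) (q : 𝒟.Path s r) (μ : Λ (r + 1))
    (h : 𝒟.Edge (q.at r hsr le_rfl) μ) :
    (q.snoc hsr μ h).at (r + 1) (hsr.trans r.le_succ) le_rfl = μ :=
  dif_neg (Nat.not_succ_le_self r)

/-- Truncation of a skew tableau by one step. -/
def SkewStd.init {s r : ℕ} (hsr : s ≤ r) {l : Λ s} {μ : Λ (r + 1)}
    (q : 𝒟.SkewStd (hsr.trans r.le_succ) l μ) : 𝒟.SkewStd hsr l (q.1.at r hsr r.le_succ) :=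
  ⟨q.1.trunc s r le_rfl r.le_succ, q.2.1, rfl⟩

/-- Extension of a skew tableau by an edge. -/
def SkewStd.snoc {s r : ℕ} {hsr : s ≤ r} {l : Λ s} {κ : Λ r} {μ : Λ (r + 1)}
    (q : 𝒟.SkewStd hsr l κ) (h : 𝒟.Edge κ μ) : 𝒟.SkewStd (hsr.trans r.le_succ) l μ :=
  ⟨q.1.snoc hsr μ (by rw [q.2.2]; exact h),
    (Path.snoc_at_of_le _ _ _ _ _ _ _ hsr).trans q.2.1, Path.snoc_at_last _ _ _ _⟩

theorem Std.comp_snoc_at {s r : ℕ} {hsr : s ≤ r} {l : Λ s} {κ : Λ r} {μ : Λ (r + 1)}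
    (p : 𝒟.Std l) (q : 𝒟.SkewStd hsr l κ) (h : 𝒟.Edge κ μ) (i : ℕ) (hi : i ≤ r) :
    (p.comp (q.snoc h)).1.at i i.zero_le (hi.trans r.le_succ) =
      (p.comp q).1.at i i.zero_le hi := by
  by_cases his : i ≤ s
  · rw [comp_at_of_le _ _ _ _ his, comp_at_of_le _ _ _ _ his]
  · rw [comp_at_of_lt _ _ _ _ (not_le.1 his), comp_at_of_lt _ _ _ _ (not_le.1 his)]
    exact dif_pos hi

theorem SkewStd.edge_init {s r : ℕ} (hsr : s ≤ r) {l : Λ s} {μ : Λ (r + 1)}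
    (q : 𝒟.SkewStd (hsr.trans r.le_succ) l μ) : 𝒟.Edge (q.1.at r hsr r.le_succ) μ := by
  have h := q.1.2 r hsr le_rfl
  have h2 : q.1.1 ⟨r + 1, hsr.trans r.le_succ, le_rfl⟩ = μ := q.2.2
  rwa [h2] at h

theorem SkewStd.init_snoc {s r : ℕ} (hsr : s ≤ r) {l : Λ s} {μ : Λ (r + 1)}
    (q : 𝒟.SkewStd (hsr.trans r.le_succ) l μ) : (q.init hsr).snoc (q.edge_init hsr) = q := by
  refine Subtype.ext (Path.ext_at fun i h₁ h₂ => ?_)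
  obtain hi | rfl := Nat.le_succ_iff.1 h₂
  · exact dif_pos hi
  · exact (dif_neg (Nat.not_succ_le_self r)).trans q.2.2.symm

theorem Std.comp_self {s : ℕ} {l : Λ s} (p : 𝒟.Std l) (q : 𝒟.SkewStd le_rfl l l) :
    p.comp q = p :=
  Subtype.ext (Path.ext_at fun _ _ h₂ => comp_at_of_le _ _ _ _ h₂)

theorem nonempty_skewStd_self {s : ℕ} (l : Λ s) : Nonempty (𝒟.SkewStd le_rfl l l) :=
  ⟨⟨⟨fun i => le_antisymm i.2.1 i.2.2 ▸ l, fun i h₁ h₂ => by omega⟩, rfl, rfl⟩⟩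

theorem dUpTo_congr {r r' : ℕ} (t : 𝒟.Path 0 r) (t' : 𝒟.Path 0 r') (k : ℕ) (h : k ≤ r)
    (h' : k ≤ r') (hag : ∀ i (hi : i ≤ k), t.at i i.zero_le (hi.trans h) =
      t'.at i i.zero_le (hi.trans h')) : 𝒟.dUpTo t k h = 𝒟.dUpTo t' k h' := by
  induction k with
  | zero => rfl
  | succ k ih =>
    rw [dUpTo, dUpTo, hag k k.le_succ, hag (k + 1) le_rfl,
      ih _ _ fun i hi => hag i (hi.trans k.le_succ)]

theorem gzUpTo_congr {r r' : ℕ} (t : 𝒟.Path 0 r) (t' : 𝒟.Path 0 r') (k : ℕ) (h : k ≤ r)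
    (h' : k ≤ r') (hag : ∀ i (hi : i ≤ k), t.at i i.zero_le (hi.trans h) =
      t'.at i i.zero_le (hi.trans h')) : 𝒟.gzUpTo t k h = 𝒟.gzUpTo t' k h' := by
  induction k with
  | zero => rfl
  | succ k ih =>
    rw [gzUpTo, gzUpTo, hag (k + 1) le_rfl, ih _ _ fun i hi => hag i (hi.trans k.le_succ)]

end Paths

variable [IsDomain R] [IsFractionRing R F] [∀ r, Finite (Λ r)] [∀ r l, Nonempty (T r l)]
  (𝒟 : DiagramTower R F A Λ T)

/-- Uses d_t = d_{κ→μ} d_{t'} and F_t = F_{t'} z_μ. The factor z_κ in `branch` is absorbed by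
F_{t'}, whose last factor it is once r ≥ 1, and z_μ acts as the identity on Δ^F(μ). -/
theorem branch_seminormal {r : ℕ} (hr : 1 ≤ r) {μ : Λ (r + 1)} {κ : Λ r} (h : 𝒟.Edge κ μ)
    (t : 𝒟.Std μ) (t' : 𝒟.Std κ) (hag : ∀ i (hi : i ≤ r),
      t.1.at i i.zero_le (hi.trans r.le_succ) = t'.1.at i i.zero_le hi) :
    𝒟.branch h (𝒟.seminormal t') = 𝒟.seminormal t := by
  rw [seminormal_eq, seminormal_eq, branch_genF_act, ← mul_assoc, centralIdem_comm, mul_assoc,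
    centralIdem_mul_gz _ hr]
  have h1 : t.1.at r r.zero_le r.le_succ = κ := (hag r le_rfl).trans t'.2
  have h2 : t.1.at (r + 1) (r + 1).zero_le le_rfl = μ := t.2
  have hd : 𝒟.dPath t.1 = 𝒟.d r κ μ * 𝒟.incl r.le_succ (𝒟.dPath t'.1) := by
    rw [dPath, dUpTo, h1, h2, dUpTo_congr t.1 t'.1 r _ le_rfl hag]
    rfl
  have hz : 𝒟.gz t.1 = 𝒟.inclF r.le_succ (𝒟.gz t'.1) * 𝒟.centralIdem μ := by
    rw [gz, gzUpTo, h2, gzUpTo_congr t.1 t'.1 r _ le_rfl hag]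
    rfl
  have hdd : (1 : F) ⊗ₜ[R] 𝒟.dPath t.1 =
      (1 ⊗ₜ[R] 𝒟.d r κ μ) * 𝒟.inclF r.le_succ (1 ⊗ₜ[R] 𝒟.dPath t'.1) := by
    rw [hd, inclF_one_tmul, Algebra.TensorProduct.tmul_mul_tmul, one_mul]
  have hb : 𝒟.branchGen κ μ = (𝒟.cellF (r + 1)).act (𝒟.genF (r + 1) μ) (1 ⊗ₜ[R] 𝒟.d r κ μ) :=
    (𝒟.genF_act_one_tmul _).symm
  rw [hz, ← mul_assoc, CellDatum.act_mul, act_centralIdem_self, hdd, mul_assoc, ← map_mul, hb,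
    ← CellDatum.act_mul]

/-- A skew tableau `q` of shape `ν ∖ lam` gives a homomorphism of cell modules over `A_s^F` which
takes `f_p` to `f_{p ∘ q}`. -/
theorem exists_pathHom {s : ℕ} (hs : 1 ≤ s) {lam : Λ s} {r : ℕ} (hsr : s ≤ r) {ν : Λ r}
    (q : 𝒟.SkewStd hsr lam ν) : ∃ φ : (T s lam → F) →ₗ[F] (T r ν → F),
      (∀ x a, φ ((𝒟.cellF s).act x a) = (𝒟.cellF r).act (φ x) (𝒟.inclF hsr a)) ∧
      ∀ p : 𝒟.Std lam, φ (𝒟.seminormal p) = 𝒟.seminormal (p.comp q) := by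
  induction r, hsr using Nat.le_induction with
  | base =>
    obtain rfl : lam = ν := q.2.1.symm.trans q.2.2
    exact ⟨LinearMap.id, fun x a => by rw [inclF_refl]; rfl, fun p => by rw [Std.comp_self]; rfl⟩
  | succ r hsr ih =>
    obtain ⟨φ, hφ, hφ'⟩ := ih (SkewStd.init hsr q)
    refine ⟨𝒟.branch (SkewStd.edge_init hsr q) ∘ₗ φ, fun x a => ?_, fun p => ?_⟩
    · rw [LinearMap.comp_apply, LinearMap.comp_apply, hφ, branch_act, inclF_inclF]
    · rw [LinearMap.comp_apply, hφ']
      refine 𝒟.branch_seminormal (hs.trans hsr) _ _ _ fun i hi => ?_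
      conv_lhs => rw [← SkewStd.init_snoc hsr q]
      exact Std.comp_snoc_at _ _ _ i hi

/-- The homomorphisms over `A_s^F` between cell modules are spanned by those of
`exists_pathHom`. -/
theorem equivariant_mem_span {s : ℕ} (hs : 1 ≤ s) {lam : Λ s} {r : ℕ} (hsr : s ≤ r) {ν : Λ r}
    (ψ : (T s lam → F) →ₗ[F] (T r ν → F))
    (hψ : ∀ x a, ψ ((𝒟.cellF s).act x a) = (𝒟.cellF r).act (ψ x) (𝒟.inclF hsr a)) :
    (fun p : 𝒟.Std lam => ψ (𝒟.seminormal p)) ∈ Submodule.span F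
      (Set.range fun (q : 𝒟.SkewStd hsr lam ν) (p : 𝒟.Std lam) => 𝒟.seminormal (p.comp q)) := by
  classical
  induction r, hsr using Nat.le_induction with
  | base =>
    by_cases hν : lam = ν
    · subst hν
      have := 𝒟.isSemisimpleRing s
      obtain ⟨c, hc⟩ := (𝒟.cellF s).exists_smul_of_equivariant ψ
        fun x a => by rw [hψ, inclF_refl]
      obtain ⟨q⟩ := nonempty_skewStd_self (𝒟 := 𝒟) lam
      convert Submodule.smul_mem _ c (Submodule.subset_span (Set.mem_range_self q)) using 1
      funext p
      rw [hc, Pi.smul_apply, Std.comp_self]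
    · convert Submodule.zero_mem _ using 1
      funext p
      -- Between different cell modules of the same level ψ vanishes: z_lam fixes the source and
      -- kills the target.
      rw [← 𝒟.act_centralIdem_self (𝒟.seminormal p), hψ, inclF_refl,
        𝒟.act_centralIdem_of_ne (Ne.symm hν)]
      rfl
  | succ r hsr ih =>
    have := Fintype.ofFinite (Λ r)
    -- Split the target by ∑ z_κ = 1 at level r. Each component factors through `branch`, so
    -- induction applies to its projection to Δ_r^F(κ).
    have hsum : (fun p : 𝒟.Std lam => ψ (𝒟.seminormal p)) = ∑ κ : Λ r, fun p : 𝒟.Std lam =>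
        (𝒟.cellF (r + 1)).act (ψ (𝒟.seminormal p)) (𝒟.inclF r.le_succ (𝒟.centralIdem κ)) := by
      funext p
      simp only [Finset.sum_apply, ← CellDatum.actₗ_apply]
      rw [← map_sum, ← map_sum, sum_centralIdem, map_one, CellDatum.actₗ_apply, CellDatum.act_one]
    rw [hsum]
    refine Submodule.sum_mem _ fun κ _ => ?_
    by_cases hκ : 𝒟.Edge κ ν
    · obtain ⟨π, hπ, hπ'⟩ := 𝒟.exists_branch_projection hκ
      have h1 := ih (π ∘ₗ ψ) fun x a => by
        rw [LinearMap.comp_apply, hψ, ← 𝒟.inclF_inclF hsr r.le_succ, hπ']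
        rfl
      have h2 := Submodule.mem_map_of_mem (f := (𝒟.branch hκ).compLeft (𝒟.Std lam)) h1
      rw [Submodule.map_span] at h2
      convert Submodule.span_mono ?_ h2 using 1
      · funext p
        exact (hπ _).symm
      · rintro _ ⟨_, ⟨q, rfl⟩, rfl⟩
        exact ⟨q.snoc hκ, funext fun p => (𝒟.branch_seminormal (hs.trans hsr) hκ _ _
          fun i hi => Std.comp_snoc_at p q hκ i hi).symm⟩
    · convert Submodule.zero_mem _ using 1
      funext p
      exact 𝒟.act_centralIdem_of_not_edge hκ _

end DiagramTower

end DiagramAlg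

/-! ### The action on seminormal vectors -/

open DiagramAlg DiagramTower in
theorem mainTheorem8 {R : Type*} [CommRing R] [IsDomain R]
    {F : Type*} [Field F] [Algebra R F] [IsFractionRing R F]
    {B : Type*} [Ring B] [Algebra R B] {A : ℕ → Subalgebra R B}
    {Λ : ℕ → Type*} [∀ r, PartialOrder (Λ r)] [∀ r, Finite (Λ r)]
    {T : ∀ r, Λ r → Type*} [∀ r l, Fintype (T r l)] [∀ r l, Nonempty (T r l)]
    (𝒟 : DiagramAlg.DiagramTower R F A Λ T)
    (s r : ℕ) (hs : 1 ≤ s) (hsr : s < r) (ν : Λ r) (t : 𝒟.Std ν)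
    (lam : Λ s) (hlam : lam = t.1.at s (Nat.zero_le s) hsr.le)
    (t₁ : 𝒟.Std lam) (ht₁ : t₁.1 = (t.head s hsr.le).1)
    (t₂ : 𝒟.SkewStd hsr.le lam ν) (ht₂ : t₂.1 = (t.tail s hsr.le).1) :
    (∀ (x : F ⊗[R] A s) (α : 𝒟.Std lam → F),
      (𝒟.cellF s).act (𝒟.seminormal t₁) x = ∑ p : 𝒟.Std lam, α p • 𝒟.seminormal p →
      (𝒟.cellF r).act (𝒟.seminormal t) (𝒟.inclF hsr.le x) =
        ∑ p : 𝒟.Std lam, α p • 𝒟.seminormal (p.comp t₂)) ∧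
    (∀ v : 𝒟.Std lam,
      (𝒟.cellF r).act (𝒟.seminormal t) (𝒟.inclF hsr.le (𝒟.seminormalCell t₁ v)) =
        (𝒟.cellF s).form (𝒟.seminormal t₁) (𝒟.seminormal t₁) • 𝒟.seminormal (v.comp t₂)) ∧
    (∀ (μ : Λ s) (u v : 𝒟.Std μ), (μ ≠ lam ∨ u.1 ≠ t₁.1) →
      (𝒟.cellF r).act (𝒟.seminormal t) (𝒟.inclF hsr.le (𝒟.seminormalCell u v)) = 0) ∧
    (∀ x : F ⊗[R] A r, (∀ y : F ⊗[R] A s, 𝒟.inclF hsr.le y * x = x * 𝒟.inclF hsr.le y) →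
      ∃ c : 𝒟.SkewStd hsr.le lam ν → F,
        (𝒟.cellF r).act (𝒟.seminormal t) x =
          ∑ q : 𝒟.SkewStd hsr.le lam ν, c q • 𝒟.seminormal (t₁.comp q) ∧
        ∀ v : 𝒟.Std lam,
          (𝒟.cellF r).act (𝒟.seminormal (v.comp t₂)) x =
            ∑ q : 𝒟.SkewStd hsr.le lam ν, c q • 𝒟.seminormal (v.comp q)) := by
  obtain rfl : t = t₁.comp t₂ := by
    refine Subtype.ext (Path.ext_at fun i h₁ h₂ => ?_)
    by_cases his : i ≤ s
    · rw [Std.comp_at_of_le _ _ _ _ his, ht₁]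
      rfl
    · rw [Std.comp_at_of_lt _ _ _ _ (not_le.1 his), ht₂]
      rfl
  obtain ⟨φ, hφ, hφ'⟩ := 𝒟.exists_pathHom hs hsr.le t₂
  refine ⟨fun x α h => ?_, fun v => ?_, fun μ u v h => ?_, fun x hx => ?_⟩
  · rw [← hφ', ← hφ, h, map_sum]
    simp only [map_smul, hφ']
  · rw [← hφ', ← hφ, seminormal_act_seminormalCell, map_smul, hφ']
  · rw [← hφ', ← hφ, seminormal_act_seminormalCell_of_ne _ hs _ _ _ h, map_zero]
  -- The map y ↦ φ(y)x is equivariant because x commutes with A_s^F. The span relation is between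
  -- families indexed by all tableaux of shape `lam`, so one choice of c serves every v.
  · have h := 𝒟.equivariant_mem_span hs hsr.le (((𝒟.cellF r).actₗ ν).flip x ∘ₗ φ) fun y a => by
      simp only [LinearMap.comp_apply, LinearMap.flip_apply, CellDatum.actₗ_apply, hφ,
        ← CellDatum.act_mul, hx]
    obtain ⟨c, hc⟩ := (Submodule.mem_span_range_iff_exists_fun F).1 h
    have key : ∀ v : 𝒟.Std lam, (𝒟.cellF r).act (𝒟.seminormal (v.comp t₂)) x =
        ∑ q : 𝒟.SkewStd hsr.le lam ν, c q • 𝒟.seminormal (v.comp q) := by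
      intro v
      have h2 := (congrFun hc v).symm
      simp only [Finset.sum_apply, Pi.smul_apply, LinearMap.comp_apply, LinearMap.flip_apply,
        CellDatum.actₗ_apply, hφ'] at h2
      exact h2
    exact ⟨c, key t₁, key⟩
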